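/- Let $k$ be a field of characteristic $0$ and let $A$ be an integer $d\times n$ matrix with $\operatorname{Ker}(A)\cap\mathbb{R}^n_{\ge 0}=\{0\}$ whose columns generate the lattice $\mathbb{Z}^d$. Assume that $A$ is unimodular: for every $b$ in the lattice spanned by the columns of $A$, all vertices of $\{x\in\mathbb{R}^n : x\ge 0,\ Ax=b\}$ are integral. Let $J_A\subset k[x_1,\dots,x_n]$ be the ideal defined by the binomials $x_1^{a_{i1}}\cdots x_n^{a_{in}}-1$, $i=1,\dots,d$; since the $a_{ij}$ may be negative, this means the set of polynomials lying in the ideal generated by these binomials in $k[x_1^{\pm1},\dots,x_n^{\pm1}]$ (if all $a_{ij}\ge 0$, it is the ideal they generate in $k[x_1,\dots,x_n]$). For $w\in\mathbb{R}^n$ with positive coordinates let $M=\mathrm{in}_w(J_A)$ be the ideal generated by the $w$-initial forms (sums of the terms of maximal $w$-weight) of the binomials in $J_A$, where a binomial is a polynomial with exactly two terms. Let $$P_w=\{u\in\mathbb{R}^n : u\ge 0,\ Au=Aw\}.$$ Assume that $w$ is generic, i.e. $Aw$ lies in the interior of a full-dimensional chamber of $A$; equivalently, $Aw$ lies in no cone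 spanned by a set of columns of $A$ that does not span $\mathbb{R}^d$. Then $P_w$ is a simple polytope, and $M$ equals the Stanley–Reisner ideal of the inner normal fan $\Sigma_w$ of $P_w$, i.e. the ideal of $k[x_1,\dots,x_n]$ generated by all square-free monomials $\prod_{i\in\tau}x_i$ for which the $i\in\tau$ do not all label rays of one common cone of $\Sigma_w$. Here $i$ labels the ray of $\Sigma_w$ normal to $P_w\cap\{u_i=0\}$ if this set is a facet of $P_w$, and labels no ray otherwise. Moreover, for every $(n-d)$-element subset $I$ of $\{1,\dots,n\}$, the equations $u_i=0$, $i\in I$, define a vertex of $P_w$ if and only if $\langle x_j : j\notin I\rangle$ is a minimal prime of $M$; and $v\mapsto\langle x_j : v_j\neq 0\rangle$ is a bijection from the vertices of $P_w$ onto the minimal primes of $M$. -/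

import Mathlib

noncomputable section

/-! ### The matrix and its polytope -/

/-- An integer matrix regarded as a real matrix. -/
def realMatrix {d n : ℕ} (A : Matrix (Fin d) (Fin n) ℤ) : Matrix (Fin d) (Fin n) ℝ :=
  A.map (fun z : ℤ => (z : ℝ))

/-- The polyhedron `P_w = {u ∈ ℝⁿ : u ≥ 0 and A u = A w}`. -/
def fiberPolytope {d n : ℕ} (A : Matrix (Fin d) (Fin n) ℤ) (w : Fin n → ℝ) :
    Set (Fin n → ℝ) :=
  {u | (∀ i, 0 ≤ u i) ∧ (realMatrix A).mulVec u = (realMatrix A).mulVec w}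

/-- `A` is unimodular: for every `b` in the lattice spanned by the columns of `A`
(that is, `b = A z` with `z` integral), all vertices of `{x : x ≥ 0, A x = b}` are integral. -/
def IsUnimodularMatrix {d n : ℕ} (A : Matrix (Fin d) (Fin n) ℤ) : Prop :=
  ∀ z : Fin n → ℤ, ∀ v ∈ (fiberPolytope A (fun i => (z i : ℝ))).extremePoints ℝ,
    ∀ i, ∃ m : ℤ, v i = m

/-- `w` is generic: `A w` lies in the interior of a full-dimensional chamber, that is, in no cone
spanned by a set of columns of `A` that does not span the whole space `ℝᵈ`. -/
def IsGenericWeight {d n : ℕ} (A : Matrix (Fin d) (Fin n) ℤ) (w : Fin n → ℝ) : Prop :=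
  ∀ σ : Set (Fin n),
    (realMatrix A).mulVec w ∈ PointedCone.hull ℝ ((realMatrix A).col '' σ) →
      Submodule.span ℝ ((realMatrix A).col '' σ) = ⊤

/-! ### The ideal of the matrix and its initial ideals -/

/-- The inclusion of the polynomial ring `k[x₁,…,xₙ]` into the Laurent polynomial ring
`k[x₁^±1,…,xₙ^±1]`, the group algebra of `ℤⁿ`. -/
def toLaurentRing (k : Type*) [Field k] (n : ℕ) :
    MvPolynomial (Fin n) k →ₐ[k] AddMonoidAlgebra k (Fin n → ℤ) :=
  MvPolynomial.aeval fun j => AddMonoidAlgebra.single (Pi.single j 1) 1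

/-- The ideal `J_A` of `k[x₁,…,xₙ]` defined by the binomials `x^{a_i} - 1`, where `a_i` runs over
the rows of `A`. As `a_i` may have negative entries, these are Laurent polynomials, and `J_A`
consists of the polynomials in the ideal that they generate in the Laurent polynomial ring.
If `A` is nonnegative without zero column, `J_A` is the ideal generated by the
polynomials `x^{a_i} - 1` in `k[x₁,…,xₙ]`, see `rowIdeal_eq_span`. -/
def rowIdeal (k : Type*) [Field k] {d n : ℕ} (A : Matrix (Fin d) (Fin n) ℤ) :
    Ideal (MvPolynomial (Fin n) k) :=
  Ideal.comap (toLaurentRing k n)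
    (Ideal.span (Set.range fun i : Fin d => AddMonoidAlgebra.single (A.row i) (1 : k) - 1))

/-- For a matrix with entries in `ℕ` and without zero column, the ideal `J_A` is generated by the
polynomials `x^{a_i} - 1`. -/
theorem rowIdeal_eq_span (k : Type*) [Field k] {d n : ℕ} (A : Matrix (Fin d) (Fin n) ℕ)
    (hA : ∀ j, ∃ i, A i j ≠ 0) :
    rowIdeal k (A.map (fun m : ℕ => (m : ℤ))) =
      Ideal.span (Set.range fun i : Fin d =>
        ∏ j, (MvPolynomial.X j : MvPolynomial (Fin n) k) ^ A i j - 1) := by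
  classical
  set J : Ideal (MvPolynomial (Fin n) k) := Ideal.span (Set.range fun i : Fin d =>
        ∏ j, (MvPolynomial.X j : MvPolynomial (Fin n) k) ^ A i j - 1) with hJ
  have himg : ∀ i : Fin d, toLaurentRing k n (∏ j, (MvPolynomial.X j) ^ A i j - 1) =
      AddMonoidAlgebra.single ((A.map (fun m : ℕ => (m : ℤ))).row i) (1 : k) - 1 := by
    intro i
    simp only [toLaurentRing, map_sub, map_one, map_prod, map_pow, MvPolynomial.aeval_X,
      AddMonoidAlgebra.single_pow, one_pow]
    congr 1
    have hprod : ∀ (s : Finset (Fin n)) (g : Fin n → Fin n → ℤ),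
        ∏ j ∈ s, (AddMonoidAlgebra.single (g j) (1 : k)) =
          AddMonoidAlgebra.single (∑ j ∈ s, g j) (1 : k) := by
      intro s g
      induction s using Finset.induction_on with
      | empty => simp [AddMonoidAlgebra.one_def]
      | insert a s ha ih => simp [Finset.prod_insert ha, Finset.sum_insert ha, ih,
          AddMonoidAlgebra.single_mul_single]
    rw [hprod]
    congr 1
    ext l
    simp [Finset.sum_apply, Pi.single_apply]
  apply le_antisymm
  · have hgen : ∀ i : Fin d,
        ∏ j, (Ideal.Quotient.mk J (MvPolynomial.X j)) ^ A i j = 1 := by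
      intro i
      have h1 : Ideal.Quotient.mk J (∏ j, (MvPolynomial.X j) ^ A i j - 1) = 0 :=
        Ideal.Quotient.eq_zero_iff_mem.2 (Ideal.subset_span ⟨i, rfl⟩)
      rw [map_sub, map_one, sub_eq_zero, map_prod] at h1
      simpa using h1
    have hunit : ∀ j, IsUnit (Ideal.Quotient.mk J (MvPolynomial.X j)) := by
      intro j
      obtain ⟨i, hi⟩ := hA j
      refine isUnit_of_dvd_one ?_
      rw [← hgen i]
      exact (dvd_pow_self _ hi).trans (Finset.dvd_prod_of_mem _ (Finset.mem_univ j))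
    choose U hU using hunit
    let φ : Multiplicative (Fin n → ℤ) →* (MvPolynomial (Fin n) k ⧸ J) :=
      { toFun := fun g => ((∏ j, U j ^ (g.toAdd j) : (MvPolynomial (Fin n) k ⧸ J)ˣ) :
          MvPolynomial (Fin n) k ⧸ J)
        map_one' := by simp
        map_mul' := by
          intro a b
          simp [zpow_add, Finset.prod_mul_distrib] }
    let Φ : AddMonoidAlgebra k (Fin n → ℤ) →ₐ[k] (MvPolynomial (Fin n) k ⧸ J) :=
      AddMonoidAlgebra.lift k _ _ φ
    have hcomp : Φ.comp (toLaurentRing k n) = Ideal.Quotient.mkₐ k J := by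
      apply MvPolynomial.algHom_ext
      intro j
      have h2 : ∏ l, U l ^ ((Pi.single j 1 : Fin n → ℤ) l) = U j := by
        rw [Finset.prod_eq_single j]
        · simp
        · intro b _ hb
          simp [Pi.single_eq_of_ne hb]
        · simp
      have h6 : Φ (AddMonoidAlgebra.single (Pi.single j 1) 1) =
          ((∏ l, U l ^ ((Pi.single j 1 : Fin n → ℤ) l) : (MvPolynomial (Fin n) k ⧸ J)ˣ) :
            MvPolynomial (Fin n) k ⧸ J) := by
        simp only [Φ, AddMonoidAlgebra.lift_single, one_smul]
        rfl
      rw [AlgHom.comp_apply, toLaurentRing, MvPolynomial.aeval_X, h6, h2, hU]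
      rfl
    have hker : Ideal.span (Set.range fun i : Fin d =>
        AddMonoidAlgebra.single ((A.map (fun m : ℕ => (m : ℤ))).row i) (1 : k) - 1) ≤
          RingHom.ker Φ.toRingHom := by
      rw [Ideal.span_le]
      rintro _ ⟨i, rfl⟩
      change Φ (AddMonoidAlgebra.single ((A.map (fun m : ℕ => (m : ℤ))).row i) (1 : k) - 1) = 0
      rw [← himg i]
      have h3 := DFunLike.congr_fun hcomp (∏ j, (MvPolynomial.X j) ^ A i j - 1)
      rw [AlgHom.comp_apply] at h3
      rw [h3]
      exact Ideal.Quotient.eq_zero_iff_mem.2 (Ideal.subset_span ⟨i, rfl⟩)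
    intro f hf
    have h4 : Φ (toLaurentRing k n f) = 0 := hker hf
    have h5 := DFunLike.congr_fun hcomp f
    rw [AlgHom.comp_apply, h4] at h5
    exact Ideal.Quotient.eq_zero_iff_mem.1 h5.symm
  · rw [hJ, Ideal.span_le]
    rintro _ ⟨i, rfl⟩
    refine Ideal.mem_comap.2 ?_
    simp only [himg i]
    exact Ideal.subset_span ⟨i, rfl⟩

/-- The `w`-initial form of a polynomial: the sum of its terms of maximal `w`-weight. -/
def initialForm {k : Type*} [Field k] {n : ℕ} (w : Fin n → ℝ) (f : MvPolynomial (Fin n) k) :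
    MvPolynomial (Fin n) k :=
  ∑ u ∈ f.support with ∀ v ∈ f.support, Finsupp.weight w v ≤ Finsupp.weight w u,
    MvPolynomial.monomial u (f.coeff u)

/-- The ideal `in_w(J)` generated by the `w`-initial forms of the binomials (the polynomials with
exactly two terms) in `J`. -/
def initialIdeal {k : Type*} [Field k] {n : ℕ} (w : Fin n → ℝ)
    (J : Ideal (MvPolynomial (Fin n) k)) : Ideal (MvPolynomial (Fin n) k) :=
  Ideal.span {g | ∃ f ∈ J, f.support.card = 2 ∧ g = initialForm w f}

/-! ### Polytopes and their normal fans -/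

/-- A polytope: the convex hull of a finite set of points. -/
def IsConvexPolytope {n : ℕ} (P : Set (Fin n → ℝ)) : Prop :=
  ∃ s : Finset (Fin n → ℝ), P = convexHull ℝ (s : Set (Fin n → ℝ))

/-- `F` is a facet of `P`: a nonempty face of codimension one. -/
def IsPolytopeFacet {n : ℕ} (P F : Set (Fin n → ℝ)) : Prop :=
  F.Nonempty ∧ IsExposed ℝ P F ∧
    Module.finrank ℝ (vectorSpan ℝ F) + 1 = Module.finrank ℝ (vectorSpan ℝ P)

/-- A polytope `P` is simple if every vertex lies in exactly `dim P` facets. -/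
def IsSimplePolytope {n : ℕ} (P : Set (Fin n → ℝ)) : Prop :=
  IsConvexPolytope P ∧
    ∀ v ∈ P.extremePoints ℝ,
      {F | IsPolytopeFacet P F ∧ v ∈ F}.encard = (Module.finrank ℝ (vectorSpan ℝ P) : ℕ∞)

/-- The (inner) normal cone of `P` at `F`: the linear functionals, on the linear space parallel to
the affine hull of `P`, that are minimized over `P` at every point of `F`. -/
def polytopeNormalCone {n : ℕ} (P F : Set (Fin n → ℝ)) :
    PointedCone ℝ (Module.Dual ℝ (vectorSpan ℝ P)) where
  carrier := {l | ∀ u ∈ F, ∀ v ∈ P, ∀ z : vectorSpan ℝ P, (z : Fin n → ℝ) = v - u → 0 ≤ l z}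
  add_mem' := fun ha hb u hu v hv z hz => add_nonneg (ha u hu v hv z hz) (hb u hu v hv z hz)
  zero_mem' := fun _ _ _ _ _ _ => le_refl 0
  smul_mem' := fun c _ ha u hu v hv z hz => mul_nonneg c.2 (ha u hu v hv z hz)

/-- The (inner) normal fan of `P`: the normal cones of the nonempty faces of `P`. -/
def polytopeNormalFan {n : ℕ} (P : Set (Fin n → ℝ)) :
    Set (PointedCone ℝ (Module.Dual ℝ (vectorSpan ℝ P))) :=
  {C | ∃ F, F.Nonempty ∧ IsExposed ℝ P F ∧ C = polytopeNormalCone P F}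

/-! ### Stanley–Reisner ideals -/

/-- The Stanley–Reisner ideal, in `k[x_i : i ∈ ι]`, of a fan `Δ` whose rays are
the cones `ρ i` for `i ∈ R`: it is generated by the square-free monomials
`∏_{i ∈ τ} x_i` for which the `i ∈ τ` do not all label rays of one common cone of `Δ`.
In particular it contains `x_i` for every `i ∉ R`. -/
def fanStanleyReisnerIdeal (k : Type*) [Field k] {ι N : Type*} [AddCommGroup N] [Module ℝ N]
    (Δ : Set (PointedCone ℝ N)) (R : Set ι) (ρ : ι → PointedCone ℝ N) :
    Ideal (MvPolynomial ι k) :=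
  Ideal.span {m | ∃ τ : Finset ι,
    (¬ ∃ C ∈ Δ, ∀ i ∈ τ, i ∈ R ∧ (ρ i).IsFaceOf C) ∧ m = ∏ i ∈ τ, MvPolynomial.X i}

/-- The face `P ∩ {u_i = 0}` of a polytope `P` in the nonnegative orthant. -/
def coordinateFace {n : ℕ} (P : Set (Fin n → ℝ)) (i : Fin n) : Set (Fin n → ℝ) :=
  {u ∈ P | u i = 0}

/-- The Stanley–Reisner ideal of the normal fan of `P_w`. The rays of the fan are the inner normals
of the facets of `P_w`; the variable `x_i` belongs to the ray normal to
the facet `P_w ∩ {u_i = 0}`, if this is a facet. -/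
def normalFanStanleyReisnerIdeal (k : Type*) [Field k] {n : ℕ} (P : Set (Fin n → ℝ)) :
    Ideal (MvPolynomial (Fin n) k) :=
  fanStanleyReisnerIdeal k (polytopeNormalFan P)
    {i | IsPolytopeFacet P (coordinateFace P i)}
    (fun i => polytopeNormalCone P (coordinateFace P i))

end

/-!
Write `b = A w` and `P = P_w`. For a set `τ` of coordinates let `P_τ` be the set of points of `P`
at which all coordinates in `τ` vanish, and call `τ` a nonface if `P_τ` is empty. Everything is
reduced to the square-free monomial ideal `nonfaceIdeal` generated by the monomials of the nonfaces.

*The polytope.* By genericity the columns in the support of a point of `P` span `ℝᵈ`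
(`exists_mulVec_eq_and_eq_of_generic`). Hence the coordinates in `τ` are independent functions on
the kernel of `A` whenever `P_τ` is nonempty, so `P_τ` has codimension `|τ|` in `P`. As every face
of `P` is some `P_τ` (`exists_eq_zeroFace_of_isExposed`), the facets are the nonempty coordinate
faces, vertices have support of size `d`, and `P` is simple. The labels in `τ` belong to rays of
one cone of the normal fan if and only if `P_τ` is nonempty (`exists_common_cone_iff`), which
identifies the Stanley–Reisner ideal with `nonfaceIdeal`.

*The initial ideal.* The binomials of `J_A` are the multiples of `x^u - x^v` with `u - v = Aᵀ y`
for an integral functional `y`, and the weights of `u` and `v` differ by `y(b)`. If `y ≠ 0` and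
`0 ≤ y(b)`, then the columns at which `y` is positive form a nonface
(`not_nonempty_zeroFace_pos`), and `x^u` is divisible by its monomial. Conversely, `b` is not in the
cone of the columns outside a nonface `τ`, and Farkas' lemma gives a functional that is positive at
`b` and nonpositive at these columns. One that vanishes on as many columns as possible vanishes on
columns spanning a hyperplane (`exists_separating_determined`). Unimodularity says that integral
vectors have integral coordinates with respect to independent columns (`exists_int_coordinate`), so
this functional can be scaled to be integral with values `0`, `1`, `-1` at all columns
(`exists_int_separating`). The initial term of the resulting binomial divides the monomial of `τ`.

*Minimal primes.* An ideal generated by variables contains `nonfaceIdeal` if and only if the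
remaining variables form a face. Every face lies in the zero set of a vertex, and vertices with
nested supports coincide, so the minimal primes are generated by the supports of the vertices.
-/

open Matrix

/-! ### Points, directions and vertices of the polytope -/

theorem exists_mulVec_eq_of_mem_span {d n : ℕ} (M : Matrix (Fin d) (Fin n) ℝ) (S : Set (Fin n))
    {b : Fin d → ℝ} (hb : b ∈ Submodule.span ℝ (M.col '' S)) :
    ∃ x : Fin n → ℝ, (∀ i, i ∉ S → x i = 0) ∧ M *ᵥ x = b := by
  induction hb using Submodule.span_induction with
  | mem b hb =>
    obtain ⟨j, hj, rfl⟩ := hb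
    refine ⟨Pi.single j 1, fun i hi => Pi.single_eq_of_ne (ne_of_mem_of_not_mem hj hi).symm _, ?_⟩
    exact mulVec_single_one M j
  | zero => exact ⟨0, fun _ _ => rfl, mulVec_zero M⟩
  | add b c _ _ hb hc =>
    obtain ⟨x, hx, rfl⟩ := hb
    obtain ⟨y, hy, rfl⟩ := hc
    exact ⟨x + y, fun i hi => by simp [hx i hi, hy i hi], mulVec_add M x y⟩
  | smul c b _ hb =>
    obtain ⟨x, hx, rfl⟩ := hb
    exact ⟨c • x, fun i hi => by simp [hx i hi], mulVec_smul M c x⟩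

theorem mulVec_mem_hull {d n : ℕ} (M : Matrix (Fin d) (Fin n) ℝ) (S : Set (Fin n))
    {u : Fin n → ℝ} (hu : ∀ i, 0 ≤ u i) (hS : ∀ i, i ∉ S → u i = 0) :
    M *ᵥ u ∈ PointedCone.hull ℝ (M.col '' S) := by
  have h : M *ᵥ u = ∑ i, u i • M.col i := by
    ext j
    simp [mulVec, dotProduct, Finset.sum_apply, mul_comm]
  rw [h]
  refine sum_mem fun i _ => ?_
  by_cases hi : i ∈ S
  · exact PointedCone.smul_mem _ (hu i) (Submodule.subset_span ⟨i, hi, rfl⟩)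
  · simp [hS i hi]

theorem convex_fiberPolytope {d n : ℕ} (A : Matrix (Fin d) (Fin n) ℤ) (w : Fin n → ℝ) :
    Convex ℝ (fiberPolytope A w) := by
  intro x hx y hy a b ha hb hab
  refine ⟨fun i => ?_, ?_⟩
  · have := mul_nonneg ha (hx.1 i)
    have := mul_nonneg hb (hy.1 i)
    simp only [Pi.add_apply, Pi.smul_apply, smul_eq_mul]
    positivity
  · rw [mulVec_add, mulVec_smul, mulVec_smul, hx.2, hy.2, ← add_smul, hab, one_smul]

/-- A point of the polytope can be moved a little in every direction `z` of the kernel that does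
not point out of the orthant; coordinates that were positive stay positive. -/
theorem exists_pos_add_smul_mem {d n : ℕ} {A : Matrix (Fin d) (Fin n) ℤ} {w u z : Fin n → ℝ}
    (hu : u ∈ fiberPolytope A w) (hz : realMatrix A *ᵥ z = 0) (hnn : ∀ i, u i = 0 → 0 ≤ z i) :
    ∃ ε : ℝ, 0 < ε ∧ u + ε • z ∈ fiberPolytope A w ∧
      ∀ i, 0 < u i → 0 < (u + ε • z) i := by
  have hev : ∀ i, ∀ᶠ t in nhdsWithin (0 : ℝ) (Set.Ioi 0), 0 < u i → 0 < u i + t * z i := by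
    intro i
    by_cases hi : 0 < u i
    · have hc : Filter.Tendsto (fun t : ℝ => u i + t * z i) (nhdsWithin 0 (Set.Ioi 0))
          (nhds (u i + 0 * z i)) :=
        (Continuous.tendsto (by fun_prop) 0).mono_left nhdsWithin_le_nhds
      filter_upwards [hc.eventually_const_lt (by simpa using hi)] with t ht _ using ht
    · exact Filter.Eventually.of_forall fun t h => absurd h hi
  obtain ⟨t, ht, ht0⟩ := ((Filter.eventually_all.2 hev).and self_mem_nhdsWithin).exists
  have ht0 : 0 < t := ht0
  refine ⟨t, ht0, ⟨fun i => ?_, ?_⟩, fun i hi => by simpa using ht i hi⟩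
  · rcases (hu.1 i).lt_or_eq with h | h
    · simpa using (ht i h).le
    · simpa [← h] using mul_nonneg ht0.le (hnn i h.symm)
  · rw [mulVec_add, mulVec_smul, hz, smul_zero, add_zero, hu.2]

/-- The vertices of the polytope are its points whose support labels linearly independent
columns. -/
theorem mem_extremePoints_fiberPolytope_iff {d n : ℕ} {A : Matrix (Fin d) (Fin n) ℤ}
    {w v : Fin n → ℝ} :
    v ∈ (fiberPolytope A w).extremePoints ℝ ↔ v ∈ fiberPolytope A w ∧
      ∀ z : Fin n → ℝ, realMatrix A *ᵥ z = 0 → (∀ i, v i = 0 → z i = 0) → z = 0 := by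
  constructor
  · intro hv
    refine ⟨hv.1, fun z hz hz0 => ?_⟩
    obtain ⟨a, ha, hma, -⟩ := exists_pos_add_smul_mem hv.1 hz (fun i hi => (hz0 i hi).ge)
    obtain ⟨b, hb, hmb, -⟩ := exists_pos_add_smul_mem (z := -z) hv.1
      (by rw [mulVec_neg, hz, neg_zero]) (fun i hi => by simp [hz0 i hi])
    have h := hv.2 hma hmb ⟨b / (a + b), a / (a + b), by positivity, by positivity, by
      field_simp; ring, by
      ext i
      simp only [Pi.add_apply, Pi.smul_apply, Pi.neg_apply, smul_eq_mul]
      field_simp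
      ring⟩
    have h2 : a • z = 0 := by simpa using h
    exact (smul_eq_zero.1 h2).resolve_left ha.ne'
  · rintro ⟨hv, hz⟩
    refine ⟨hv, fun x hx y hy hxy => ?_⟩
    obtain ⟨a, b, ha, hb, hab, rfl⟩ := hxy
    have h := hz (x - (a • x + b • y)) (by rw [mulVec_sub, hx.2, hv.2, sub_self]) (fun i hi => by
      have h1 := mul_nonneg ha.le (hx.1 i)
      have h2 := mul_nonneg hb.le (hy.1 i)
      simp only [Pi.add_apply, Pi.smul_apply, smul_eq_mul] at hi
      have h3 : a * x i = 0 := by linarith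
      have h4 : x i = 0 := (mul_eq_zero.1 h3).resolve_left ha.ne'
      change x i - (a * x i + b * y i) = 0
      rw [hi, h4, sub_zero])
    exact sub_eq_zero.1 h

theorem eq_of_mem_extremePoints_of_support_le {d n : ℕ} {A : Matrix (Fin d) (Fin n) ℤ}
    {w u v : Fin n → ℝ} (hv : v ∈ (fiberPolytope A w).extremePoints ℝ)
    (hu : u ∈ fiberPolytope A w) (h : ∀ i, v i = 0 → u i = 0) : u = v := by
  rw [mem_extremePoints_fiberPolytope_iff] at hv
  refine sub_eq_zero.1 (hv.2 (u - v) (by rw [mulVec_sub, hu.2, hv.1.2, sub_self]) fun i hi => ?_)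
  simp [hi, h i hi]

theorem finite_extremePoints_fiberPolytope {d n : ℕ} (A : Matrix (Fin d) (Fin n) ℤ)
    (w : Fin n → ℝ) : ((fiberPolytope A w).extremePoints ℝ).Finite := by
  refine Set.Finite.of_finite_image (f := fun v => {i | v i = 0}) (Set.toFinite _) ?_
  intro u hu v hv huv
  exact eq_of_mem_extremePoints_of_support_le hv hu.1 fun i hi =>
    (Set.ext_iff.1 huv i).2 hi

/-! ### Compactness and separation -/

section Compact

variable {d n : ℕ} {M : Matrix (Fin d) (Fin n) ℝ}

/-- If the kernel meets the orthant only at the origin, then `u ↦ M u` is bounded below on the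
orthant, as it is on the standard simplex. -/
theorem exists_sum_le_mul_norm_mulVec
    (hker : ∀ x : Fin n → ℝ, (∀ i, 0 ≤ x i) → M *ᵥ x = 0 → x = 0) :
    ∃ C : ℝ, ∀ u : Fin n → ℝ, (∀ i, 0 ≤ u i) → ∑ i, u i ≤ C * ‖M *ᵥ u‖ := by
  have hcont : Continuous fun u : Fin n → ℝ => ‖M *ᵥ u‖ :=
    (Continuous.matrix_mulVec continuous_const continuous_id).norm
  rcases (stdSimplex ℝ (Fin n)).eq_empty_or_nonempty with he | hne
  · refine ⟨0, fun u hu => ?_⟩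
    have : IsEmpty (Fin n) := by
      by_contra h
      rw [not_isEmpty_iff] at h
      obtain ⟨i⟩ := h
      exact (he ▸ single_mem_stdSimplex ℝ i : _ ∈ (∅ : Set _))
    simp
  · obtain ⟨p, hp, hmin⟩ := (isCompact_stdSimplex ℝ (Fin n)).exists_isMinOn hne hcont.continuousOn
    have hpos : 0 < ‖M *ᵥ p‖ := by
      rw [norm_pos_iff]
      intro h
      have h0 := hker p hp.1 h
      have h1 := hp.2
      simp [h0] at h1
    refine ⟨‖M *ᵥ p‖⁻¹, fun u hu => ?_⟩
    rcases (Finset.sum_nonneg fun i _ => hu i : 0 ≤ ∑ i, u i).lt_or_eq with hs | hs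
    · have hmem : (∑ i, u i)⁻¹ • u ∈ stdSimplex ℝ (Fin n) := by
        refine ⟨fun i => mul_nonneg (inv_nonneg.2 hs.le) (hu i), ?_⟩
        simp only [Pi.smul_apply, smul_eq_mul, ← Finset.mul_sum]
        exact inv_mul_cancel₀ hs.ne'
      have h := hmin hmem
      simp only [Set.mem_ofPred_eq] at h
      rw [mulVec_smul, norm_smul, norm_inv, Real.norm_of_nonneg hs.le] at h
      rw [inv_mul_eq_div, le_div_iff₀ hpos]
      rw [inv_mul_eq_div, le_div_iff₀ hs] at h
      linarith
    · rw [← hs]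
      positivity

theorem isCompact_fiberPolytope {A : Matrix (Fin d) (Fin n) ℤ}
    (hker : ∀ x : Fin n → ℝ, (∀ i, 0 ≤ x i) → realMatrix A *ᵥ x = 0 → x = 0) (w : Fin n → ℝ) :
    IsCompact (fiberPolytope A w) := by
  obtain ⟨C, hC⟩ := exists_sum_le_mul_norm_mulVec hker
  have hcl : IsClosed (fiberPolytope A w) := by
    have h1 : IsClosed {u : Fin n → ℝ | ∀ i, 0 ≤ u i} := by
      simp only [Set.ofPred_forall]
      exact isClosed_iInter fun i => isClosed_le continuous_const (continuous_apply i)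
    exact h1.inter (isClosed_eq (Continuous.matrix_mulVec continuous_const continuous_id)
      continuous_const)
  refine (isCompact_Icc (a := (0 : Fin n → ℝ))
    (b := fun _ => C * ‖realMatrix A *ᵥ w‖)).of_isClosed_subset hcl ?_
  intro u hu
  refine ⟨hu.1, fun i => ?_⟩
  calc u i ≤ ∑ i, u i := Finset.single_le_sum (fun j _ => hu.1 j) (Finset.mem_univ i)
    _ ≤ _ := hu.2 ▸ hC u hu.1

theorem isClosed_image_mulVec_orthant
    (hker : ∀ x : Fin n → ℝ, (∀ i, 0 ≤ x i) → M *ᵥ x = 0 → x = 0) (τ : Finset (Fin n)) :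
    IsClosed ((fun u => M *ᵥ u) '' {u : Fin n → ℝ | (∀ i, 0 ≤ u i) ∧ ∀ i ∈ τ, u i = 0}) := by
  obtain ⟨C, hC⟩ := exists_sum_le_mul_norm_mulVec hker
  set T : Set (Fin n → ℝ) := {u | (∀ i, 0 ≤ u i) ∧ ∀ i ∈ τ, u i = 0} with hT
  have hTcl : IsClosed T := by
    have h1 : IsClosed {u : Fin n → ℝ | ∀ i, 0 ≤ u i} := by
      simp only [Set.ofPred_forall]
      exact isClosed_iInter fun i => isClosed_le continuous_const (continuous_apply i)
    have h2 : IsClosed {u : Fin n → ℝ | ∀ i ∈ τ, u i = 0} := by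
      simp only [Set.ofPred_forall]
      exact isClosed_iInter fun i => isClosed_iInter fun _ =>
        isClosed_eq (continuous_apply i) continuous_const
    exact h1.inter h2
  -- near `b` the cone is the image of a compact part of the orthant
  refine isClosed_of_closure_subset fun b hb => ?_
  have hcomp : IsCompact ((fun u => M *ᵥ u) ''
      (Set.Icc 0 (fun _ => |C| * (‖b‖ + 1)) ∩ T)) :=
    (isCompact_Icc.inter_right hTcl).image (Continuous.matrix_mulVec continuous_const continuous_id)
  have hsub : Metric.ball b 1 ∩ ((fun u => M *ᵥ u) '' T) ⊆
      (fun u => M *ᵥ u) '' (Set.Icc 0 (fun _ => |C| * (‖b‖ + 1)) ∩ T) := by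
    rintro _ ⟨hball, u, hu, rfl⟩
    refine ⟨u, ⟨⟨hu.1, fun i => ?_⟩, hu⟩, rfl⟩
    have hn : ‖M *ᵥ u‖ ≤ ‖b‖ + 1 := by
      have h1 : ‖M *ᵥ u - b‖ < 1 := by simpa [dist_eq_norm] using hball
      have h2 := norm_sub_norm_le (M *ᵥ u) b
      linarith
    calc u i ≤ ∑ i, u i := Finset.single_le_sum (fun j _ => hu.1 j) (Finset.mem_univ i)
      _ ≤ C * ‖M *ᵥ u‖ := hC u hu.1
      _ ≤ |C| * (‖b‖ + 1) := mul_le_mul (le_abs_self C) hn (norm_nonneg _) (abs_nonneg C)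
  have hb' := Metric.isOpen_ball.inter_closure ⟨Metric.mem_ball_self one_pos, hb⟩
  exact Set.image_mono Set.inter_subset_right (closure_minimal hsub hcomp.isClosed hb')

theorem exists_dotProduct_eq_linearMap (f : (Fin d → ℝ) →ₗ[ℝ] ℝ) :
    ∃ y : Fin d → ℝ, ∀ b, f b = y ⬝ᵥ b := by
  refine ⟨fun i => f (Pi.single i 1), fun b => ?_⟩
  conv_lhs => rw [pi_eq_sum_univ' b]
  simp [dotProduct, mul_comm]

/-- Farkas' lemma for the cone of the columns outside `τ`. -/
theorem exists_separating_of_notMem_cone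
    (hker : ∀ x : Fin n → ℝ, (∀ i, 0 ≤ x i) → M *ᵥ x = 0 → x = 0) (τ : Finset (Fin n))
    {b : Fin d → ℝ} (hb : ∀ u : Fin n → ℝ, (∀ i, 0 ≤ u i) → (∀ i ∈ τ, u i = 0) → M *ᵥ u ≠ b) :
    ∃ y : Fin d → ℝ, 0 < y ⬝ᵥ b ∧ ∀ j, j ∉ τ → (y ᵥ* M) j ≤ 0 := by
  have hconv : Convex ℝ ((fun u => M *ᵥ u) ''
      {u : Fin n → ℝ | (∀ i, 0 ≤ u i) ∧ ∀ i ∈ τ, u i = 0}) := by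
    refine Convex.linear_image (f := M.mulVecLin) ?_
    intro x hx y hy a b ha hb _
    refine ⟨fun i => ?_, fun i hi => by simp [hx.2 i hi, hy.2 i hi]⟩
    have := mul_nonneg ha (hx.1 i)
    have := mul_nonneg hb (hy.1 i)
    simp only [Pi.add_apply, Pi.smul_apply, smul_eq_mul]
    positivity
  obtain ⟨f, s, hs, hfb⟩ := geometric_hahn_banach_closed_point hconv
    (isClosed_image_mulVec_orthant hker τ) (x := b) (by
      rintro ⟨u, hu, rfl⟩
      exact hb u hu.1 hu.2 rfl)
  obtain ⟨y, hy⟩ := exists_dotProduct_eq_linearMap f.toLinearMap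
  have hy : ∀ b, f b = y ⬝ᵥ b := hy
  have hs0 : 0 < s := by
    have := hs 0 ⟨0, by simp, by simp⟩
    simpa using this
  refine ⟨y, by rw [← hy]; exact hs0.trans hfb, fun j hj => ?_⟩
  by_contra! hpos
  -- a multiple of the `j`-th column violates the separating inequality
  have h := hs (M *ᵥ Pi.single j (s / (y ᵥ* M) j)) ⟨_, ⟨fun i => ?_, fun i hi => ?_⟩, rfl⟩
  · rw [hy, dotProduct_mulVec, dotProduct_single, mul_div_cancel₀ _ hpos.ne'] at h
    exact lt_irrefl _ h
  · rcases eq_or_ne i j with rfl | hij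
    · simpa using (div_pos hs0 hpos).le
    · simp [hij]
  · exact Pi.single_eq_of_ne (ne_of_mem_of_not_mem hi hj) _

end Compact

/-! ### Faces of the polytope of a generic weight -/

/-- The points of `P` at which all coordinates in `τ` vanish. -/
def zeroFace {n : ℕ} (P : Set (Fin n → ℝ)) (τ : Finset (Fin n)) : Set (Fin n → ℝ) :=
  {u ∈ P | ∀ i ∈ τ, u i = 0}

/-- The vectors of the kernel of `M` whose coordinates in `τ` vanish: the linear space parallel to
the face `zeroFace P τ`. -/
def kernelVanishingOn {d n : ℕ} (M : Matrix (Fin d) (Fin n) ℝ) (τ : Finset (Fin n)) :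
    Submodule ℝ (Fin n → ℝ) :=
  LinearMap.ker (M.mulVecLin.prod (LinearMap.funLeft ℝ ℝ (Subtype.val : τ → Fin n)))

theorem mem_kernelVanishingOn {d n : ℕ} {M : Matrix (Fin d) (Fin n) ℝ} {τ : Finset (Fin n)}
    {z : Fin n → ℝ} : z ∈ kernelVanishingOn M τ ↔ M *ᵥ z = 0 ∧ ∀ i ∈ τ, z i = 0 := by
  simp [kernelVanishingOn, LinearMap.mem_ker, funext_iff, LinearMap.funLeft]

section Generic

variable {d n : ℕ} {A : Matrix (Fin d) (Fin n) ℤ} {w : Fin n → ℝ}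

theorem zeroFace_empty (P : Set (Fin n → ℝ)) : zeroFace P ∅ = P := by
  simp [zeroFace]

theorem zeroFace_singleton (P : Set (Fin n → ℝ)) (i : Fin n) :
    zeroFace P {i} = coordinateFace P i := by
  simp [zeroFace, coordinateFace]

/-- For generic `w` the columns in the support of a point of the polytope span the space, so the
image under `A` and the coordinates off the support can be prescribed simultaneously. -/
theorem exists_mulVec_eq_and_eq_of_generic (hgen : IsGenericWeight A w) {u : Fin n → ℝ}
    (hu : u ∈ fiberPolytope A w) (b : Fin d → ℝ) (c : Fin n → ℝ) :
    ∃ z : Fin n → ℝ, realMatrix A *ᵥ z = b ∧ ∀ i, u i = 0 → z i = c i := by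
  classical
  have hspan := hgen {i | u i ≠ 0} (hu.2 ▸ mulVec_mem_hull _ _ hu.1 (by simp))
  set c' : Fin n → ℝ := fun i => if u i = 0 then c i else 0 with hc'
  obtain ⟨x, hx, hxb⟩ := exists_mulVec_eq_of_mem_span (realMatrix A) {i | u i ≠ 0}
    (b := b - realMatrix A *ᵥ c') (hspan ▸ Submodule.mem_top)
  refine ⟨x + c', by rw [mulVec_add, hxb, sub_add_cancel], fun i hi => ?_⟩
  simp [hx i (by simp [hi]), hc', hi]

theorem finrank_kernelVanishingOn (hgen : IsGenericWeight A w) {τ : Finset (Fin n)}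
    (hτ : (zeroFace (fiberPolytope A w) τ).Nonempty) :
    Module.finrank ℝ (kernelVanishingOn (realMatrix A) τ) + τ.card + d = n := by
  classical
  obtain ⟨u, hu, huτ⟩ := hτ
  have hsurj : Function.Surjective ((realMatrix A).mulVecLin.prod
      (LinearMap.funLeft ℝ ℝ (Subtype.val : τ → Fin n))) := by
    rintro ⟨b, c⟩
    obtain ⟨z, hz, hzc⟩ := exists_mulVec_eq_and_eq_of_generic hgen hu b
      (fun i => if h : i ∈ τ then c ⟨i, h⟩ else 0)
    refine ⟨z, Prod.ext hz (funext fun i => ?_)⟩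
    simp [LinearMap.funLeft, hzc i (huτ i i.2)]
  have h := LinearMap.finrank_range_add_finrank_ker ((realMatrix A).mulVecLin.prod
      (LinearMap.funLeft ℝ ℝ (Subtype.val : τ → Fin n)))
  rw [LinearMap.range_eq_top.2 hsurj, finrank_top, Module.finrank_prod] at h
  simp only [Module.finrank_fintype_fun_eq_card, Fintype.card_coe, Fintype.card_fin] at h
  rw [kernelVanishingOn]
  omega

/-- A nonempty face `zeroFace P τ` has a point at which no coordinate outside `τ` vanishes. -/
theorem exists_mem_eq_zero_iff (hgen : IsGenericWeight A w) {τ : Finset (Fin n)}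
    (hτ : (zeroFace (fiberPolytope A w) τ).Nonempty) :
    ∃ u ∈ fiberPolytope A w, ∀ i, u i = 0 ↔ i ∈ τ := by
  classical
  obtain ⟨u, hu, huτ⟩ := hτ
  obtain ⟨z, hz, hz1⟩ := exists_mulVec_eq_and_eq_of_generic hgen hu 0
    (fun i => if i ∈ τ then 0 else 1)
  obtain ⟨ε, hε, hmem, hpos⟩ := exists_pos_add_smul_mem hu hz (fun i hi => by
    rw [hz1 i hi]; split_ifs <;> norm_num)
  refine ⟨u + ε • z, hmem, fun i => ⟨fun h => ?_, fun h => ?_⟩⟩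
  · rcases (hu.1 i).lt_or_eq with h' | h'
    · exact absurd h (hpos i h').ne'
    · by_contra hi
      have := hz1 i h'.symm
      rw [if_neg hi] at this
      simp only [Pi.add_apply, Pi.smul_apply, smul_eq_mul, ← h', this] at h
      linarith
  · simp [huτ i h, hz1 i (huτ i h), h]

theorem vectorSpan_zeroFace (hgen : IsGenericWeight A w) {τ : Finset (Fin n)}
    (hτ : (zeroFace (fiberPolytope A w) τ).Nonempty) :
    vectorSpan ℝ (zeroFace (fiberPolytope A w) τ) = kernelVanishingOn (realMatrix A) τ := by
  apply le_antisymm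
  · rw [vectorSpan_def, Submodule.span_le]
    rintro _ ⟨x, hx, y, hy, rfl⟩
    refine mem_kernelVanishingOn.2 ⟨?_, fun i hi => ?_⟩
    · change realMatrix A *ᵥ (x - y) = 0
      rw [mulVec_sub, hx.1.2, hy.1.2, sub_self]
    · simp [hx.2 i hi, hy.2 i hi]
  · intro z hz
    obtain ⟨hz, hzτ⟩ := mem_kernelVanishingOn.1 hz
    obtain ⟨u, hu, huτ⟩ := exists_mem_eq_zero_iff hgen hτ
    obtain ⟨ε, hε, hmem, -⟩ := exists_pos_add_smul_mem hu hz
      (fun i hi => (hzτ i ((huτ i).1 hi)).ge)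
    have h : (u + ε • z) -ᵥ u ∈ vectorSpan ℝ (zeroFace (fiberPolytope A w) τ) :=
      vsub_mem_vectorSpan ℝ
        ⟨hmem, fun i hi => by simp [(huτ i).2 hi, hzτ i hi]⟩ ⟨hu, fun i hi => (huτ i).2 hi⟩
    rw [vsub_eq_sub, add_sub_cancel_left] at h
    exact (Submodule.smul_mem_iff _ hε.ne').1 h

theorem finrank_vectorSpan_zeroFace (hgen : IsGenericWeight A w) {τ : Finset (Fin n)}
    (hτ : (zeroFace (fiberPolytope A w) τ).Nonempty) :
    Module.finrank ℝ (vectorSpan ℝ (zeroFace (fiberPolytope A w) τ)) + τ.card + d = n := by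
  rw [vectorSpan_zeroFace hgen hτ]
  exact finrank_kernelVanishingOn hgen hτ

theorem isExposed_zeroFace (τ : Finset (Fin n)) :
    IsExposed ℝ (fiberPolytope A w) (zeroFace (fiberPolytope A w) τ) := by
  rintro ⟨u, hu, huτ⟩
  refine ⟨-∑ i ∈ τ, ContinuousLinearMap.proj i, ?_⟩
  have hval : ∀ x : Fin n → ℝ,
      (-∑ i ∈ τ, ContinuousLinearMap.proj i : StrongDual ℝ (Fin n → ℝ)) x = -∑ i ∈ τ, x i := by
    intro x
    simp
  ext x
  simp only [zeroFace, Set.mem_ofPred_eq, hval, neg_le_neg_iff]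
  refine and_congr_right fun hx => ⟨fun h y hy => ?_, fun h => ?_⟩
  · rw [Finset.sum_eq_zero h]
    exact Finset.sum_nonneg fun i _ => hy.1 i
  · have h0 := h u hu
    rw [Finset.sum_eq_zero huτ] at h0
    exact (Finset.sum_eq_zero_iff_of_nonneg fun i _ => hx.1 i).1
      (le_antisymm h0 (Finset.sum_nonneg fun i _ => hx.1 i))

/-- Every nonempty face is cut out by the vanishing of coordinates, namely of those that vanish
at one of its points with largest support. -/
theorem exists_eq_zeroFace_of_isExposed {F : Set (Fin n → ℝ)} (hne : F.Nonempty)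
    (hF : IsExposed ℝ (fiberPolytope A w) F) :
    ∃ τ : Finset (Fin n), F = zeroFace (fiberPolytope A w) τ := by
  classical
  obtain ⟨u, huF, hmin⟩ := (measure fun u : Fin n → ℝ =>
    (Finset.univ.filter fun i => u i = 0).card).wf.has_min F hne
  have hu : u ∈ fiberPolytope A w := hF.subset huF
  refine ⟨Finset.univ.filter fun i => u i = 0, Set.Subset.antisymm (fun x hx => ?_) ?_⟩
  · refine ⟨hF.subset hx, fun i hi => ?_⟩
    have hi : u i = 0 := by simpa using hi
    by_contra hxi
    have hxP := hF.subset hx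
    refine hmin _ (hF.convex (convex_fiberPolytope A w) hx huF (by norm_num : (0 : ℝ) ≤ 1 / 2)
      (by norm_num : (0 : ℝ) ≤ 1 / 2) (by norm_num)) (Finset.card_lt_card ?_)
    refine ⟨fun j hj => ?_, fun hsub => ?_⟩
    · have h1 := hxP.1 j
      have h2 := hu.1 j
      simp only [Finset.mem_filter, Finset.mem_univ, true_and, Pi.add_apply, Pi.smul_apply,
        smul_eq_mul] at hj ⊢
      linarith
    · have := hsub (by simpa using hi : i ∈ Finset.univ.filter fun i => u i = 0)
      simp [hi, hxi] at this
  · rintro x ⟨hx, hxτ⟩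
    obtain ⟨l, hl⟩ := hF hne
    obtain ⟨ε, hε, hmem, -⟩ := exists_pos_add_smul_mem (z := u - x) hu
      (by rw [mulVec_sub, hu.2, hx.2, sub_self]) (fun i hi => by simp [hi, hxτ i (by simpa using hi)])
    have huF' := huF
    rw [hl] at huF' ⊢
    refine ⟨hx, fun y hy => (huF'.2 y hy).trans ?_⟩
    have h := huF'.2 _ hmem
    rw [map_add, map_smul, map_sub, smul_eq_mul] at h
    have h2 : ε * (l u - l x) ≤ 0 := by linarith
    have h3 := nonpos_of_mul_nonpos_right h2 hε
    linarith

theorem mem_fiberPolytope_self (hw : ∀ i, 0 < w i) : w ∈ fiberPolytope A w :=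
  ⟨fun i => (hw i).le, rfl⟩

theorem isPolytopeFacet_fiberPolytope_iff (hw : ∀ i, 0 < w i) (hgen : IsGenericWeight A w)
    {F : Set (Fin n → ℝ)} :
    IsPolytopeFacet (fiberPolytope A w) F ↔
      F.Nonempty ∧ ∃ i, F = coordinateFace (fiberPolytope A w) i := by
  have hP := finrank_vectorSpan_zeroFace hgen (τ := ∅)
    (by rw [zeroFace_empty]; exact ⟨w, mem_fiberPolytope_self hw⟩)
  rw [zeroFace_empty, Finset.card_empty] at hP
  constructor
  · rintro ⟨hne, hexp, hdim⟩
    obtain ⟨τ, rfl⟩ := exists_eq_zeroFace_of_isExposed hne hexp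
    have h := finrank_vectorSpan_zeroFace hgen hne
    obtain ⟨i, rfl⟩ := Finset.card_eq_one.1 (by omega : τ.card = 1)
    exact ⟨hne, i, zeroFace_singleton _ i⟩
  · rintro ⟨hne, i, rfl⟩
    rw [← zeroFace_singleton] at hne ⊢
    have h := finrank_vectorSpan_zeroFace hgen hne
    rw [Finset.card_singleton] at h
    exact ⟨hne, isExposed_zeroFace _, by omega⟩

/-- A nonempty face contains a vertex of the polytope. -/
theorem exists_extremePoint_mem_zeroFace
    (hker : ∀ x : Fin n → ℝ, (∀ i, 0 ≤ x i) → realMatrix A *ᵥ x = 0 → x = 0)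
    {τ : Finset (Fin n)} (hτ : (zeroFace (fiberPolytope A w) τ).Nonempty) :
    ∃ v ∈ (fiberPolytope A w).extremePoints ℝ, ∀ i ∈ τ, v i = 0 := by
  have hexp : IsExposed ℝ (fiberPolytope A w) (zeroFace (fiberPolytope A w) τ) :=
    isExposed_zeroFace τ
  obtain ⟨v, hv⟩ := (hexp.isCompact (isCompact_fiberPolytope hker w)).extremePoints_nonempty hτ
  exact ⟨v, hexp.isExtreme.extremePoints_subset_extremePoints hv, hv.1.2⟩

open Classical in
/-- A vertex of the polytope of a generic weight has exactly `d` nonzero coordinates. -/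
theorem card_filter_eq_zero_of_mem_extremePoints (hgen : IsGenericWeight A w) {v : Fin n → ℝ}
    (hv : v ∈ (fiberPolytope A w).extremePoints ℝ) :
    (Finset.univ.filter fun i => v i = 0).card + d = n := by
  have h := finrank_kernelVanishingOn hgen (τ := Finset.univ.filter fun i => v i = 0)
    ⟨v, hv.1, by simp⟩
  have hbot : kernelVanishingOn (realMatrix A) (Finset.univ.filter fun i => v i = 0) = ⊥ := by
    rw [Submodule.eq_bot_iff]
    intro z hz
    obtain ⟨hz, hz0⟩ := mem_kernelVanishingOn.1 hz
    exact (mem_extremePoints_fiberPolytope_iff.1 hv).2 z hz (by simpa using hz0)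
  rw [hbot, finrank_bot] at h
  omega

theorem isConvexPolytope_fiberPolytope
    (hker : ∀ x : Fin n → ℝ, (∀ i, 0 ≤ x i) → realMatrix A *ᵥ x = 0 → x = 0) (w : Fin n → ℝ) :
    IsConvexPolytope (fiberPolytope A w) := by
  have hfin := finite_extremePoints_fiberPolytope A w
  refine ⟨hfin.toFinset, ?_⟩
  rw [hfin.coe_toFinset, ← hfin.isClosed_convexHull (𝕜 := ℝ) |>.closure_eq]
  exact (closure_convexHull_extremePoints (isCompact_fiberPolytope hker w)
    (convex_fiberPolytope A w)).symm

/-- The facets through a vertex `v` are the coordinate faces with `v i = 0`, which are pairwise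
distinct. -/
theorem isSimplePolytope_fiberPolytope
    (hker : ∀ x : Fin n → ℝ, (∀ i, 0 ≤ x i) → realMatrix A *ᵥ x = 0 → x = 0)
    (hw : ∀ i, 0 < w i) (hgen : IsGenericWeight A w) :
    IsSimplePolytope (fiberPolytope A w) := by
  classical
  refine ⟨isConvexPolytope_fiberPolytope hker w, fun v hv => ?_⟩
  have hset : {F | IsPolytopeFacet (fiberPolytope A w) F ∧ v ∈ F} =
      coordinateFace (fiberPolytope A w) ''
        ((Finset.univ.filter fun i => v i = 0 : Finset (Fin n)) : Set (Fin n)) := by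
    ext F
    simp only [Set.mem_ofPred_eq, isPolytopeFacet_fiberPolytope_iff hw hgen, Set.mem_image,
      Finset.coe_filter, Finset.mem_univ, true_and]
    constructor
    · rintro ⟨⟨-, i, rfl⟩, hvF⟩
      exact ⟨i, hvF.2, rfl⟩
    · rintro ⟨i, hi, rfl⟩
      exact ⟨⟨⟨v, hv.1, hi⟩, i, rfl⟩, hv.1, hi⟩
  have hinj : Set.InjOn (coordinateFace (fiberPolytope A w))
      ((Finset.univ.filter fun i => v i = 0 : Finset (Fin n)) : Set (Fin n)) := by
    intro i hi j _ hij
    obtain ⟨u, hu, hui⟩ := exists_mem_eq_zero_iff hgen (τ := {i})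
      ⟨v, hv.1, by simpa using hi⟩
    have : u ∈ coordinateFace (fiberPolytope A w) j := hij ▸ ⟨hu, (hui i).2 (by simp)⟩
    exact (by simpa using (hui j).1 this.2 : j = i).symm
  have hP := finrank_vectorSpan_zeroFace hgen (τ := ∅)
    (by rw [zeroFace_empty]; exact ⟨w, mem_fiberPolytope_self hw⟩)
  rw [zeroFace_empty, Finset.card_empty] at hP
  have hcard := card_filter_eq_zero_of_mem_extremePoints hgen hv
  rw [hset, hinj.encard_image, Set.encard_coe_eq_coe_finsetCard]
  norm_cast
  omega

/-! ### The normal fan -/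

theorem polytopeNormalCone_anti (P : Set (Fin n → ℝ)) {F G : Set (Fin n → ℝ)} (h : G ⊆ F) :
    polytopeNormalCone P F ≤ polytopeNormalCone P G :=
  fun _ hl u hu => hl u (h hu)

/-- The normal cone of a face is a face of the normal cone of each smaller nonempty face. -/
theorem isFaceOf_polytopeNormalCone {P F G : Set (Fin n → ℝ)} (hFP : F ⊆ P) (hG : G.Nonempty)
    (hGF : G ⊆ F) : (polytopeNormalCone P F).IsFaceOf (polytopeNormalCone P G) := by
  refine ⟨polytopeNormalCone_anti P hGF, ?_⟩
  obtain ⟨p, hp⟩ := hG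
  intro x y a hx hy ha hxy u hu v hv z hz
  have hup : u - p ∈ vectorSpan ℝ P := vsub_mem_vectorSpan ℝ (hFP hu) (hFP (hGF hp))
  have hvp : v - p ∈ vectorSpan ℝ P := vsub_mem_vectorSpan ℝ hv (hFP (hGF hp))
  have hpu : p - u ∈ vectorSpan ℝ P := vsub_mem_vectorSpan ℝ (hFP (hGF hp)) (hFP hu)
  have h1 := hx p hp u (hFP hu) ⟨_, hup⟩ rfl
  have h2 := hy p hp u (hFP hu) ⟨_, hup⟩ rfl
  have h3 := hxy u hu p (hFP (hGF hp)) ⟨_, hpu⟩ rfl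
  have h4 := hx p hp v hv ⟨_, hvp⟩ rfl
  have e1 : (⟨p - u, hpu⟩ : vectorSpan ℝ P) = -⟨u - p, hup⟩ := Subtype.ext (by simp)
  have e2 : z = ⟨v - p, hvp⟩ - ⟨u - p, hup⟩ := Subtype.ext (by simp [hz])
  rw [e1, map_neg, LinearMap.add_apply, LinearMap.smul_apply, smul_eq_mul] at h3
  have h5 : a * x ⟨u - p, hup⟩ ≤ 0 := by linarith
  have h6 := nonpos_of_mul_nonpos_right h5 ha
  rw [e2, map_sub]
  linarith

/-- Coordinates in `τ` label rays of one common cone of the normal fan if and only if they vanish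
simultaneously somewhere on the polytope. -/
theorem exists_common_cone_iff (hw : ∀ i, 0 < w i) (hgen : IsGenericWeight A w)
    (τ : Finset (Fin n)) :
    (∃ C ∈ polytopeNormalFan (fiberPolytope A w), ∀ i ∈ τ,
        i ∈ {i | IsPolytopeFacet (fiberPolytope A w) (coordinateFace (fiberPolytope A w) i)} ∧
        (polytopeNormalCone (fiberPolytope A w)
          (coordinateFace (fiberPolytope A w) i)).IsFaceOf C) ↔
      (zeroFace (fiberPolytope A w) τ).Nonempty := by
  constructor
  · rintro ⟨C, ⟨F, ⟨p, hp⟩, hexp, rfl⟩, hC⟩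
    refine ⟨p, hexp.subset hp, fun i hi => ?_⟩
    obtain ⟨⟨⟨u, hu, hui⟩, -⟩, hface⟩ := hC i hi
    -- the `i`-th coordinate is minimal on its coordinate face, hence on `F`
    have hmem : (LinearMap.proj i : (Fin n → ℝ) →ₗ[ℝ] ℝ).comp
        (vectorSpan ℝ (fiberPolytope A w)).subtype ∈
        polytopeNormalCone (fiberPolytope A w) (coordinateFace (fiberPolytope A w) i) := by
      intro x hx v hv z hz
      have : (z : Fin n → ℝ) i = v i - x i := by rw [hz]; rfl
      simp [this, hx.2, hv.1 i]
    have h := hface.le hmem p hp u hu ⟨u - p, vsub_mem_vectorSpan ℝ hu (hexp.subset hp)⟩ rfl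
    have h : 0 ≤ u i - p i := h
    linarith [(hexp.subset hp).1 i]
  · intro hne
    refine ⟨_, ⟨zeroFace (fiberPolytope A w) τ, hne, isExposed_zeroFace τ, rfl⟩, fun i hi => ?_⟩
    have hsub : zeroFace (fiberPolytope A w) τ ⊆ coordinateFace (fiberPolytope A w) i :=
      fun u hu => ⟨hu.1, hu.2 i hi⟩
    exact ⟨(isPolytopeFacet_fiberPolytope_iff hw hgen).2 ⟨hne.mono hsub, i, rfl⟩,
      isFaceOf_polytopeNormalCone (fun u hu => hu.1) hne hsub⟩

/-- The ideal of nonfaces: generated by the square-free monomials `∏_{i ∈ τ} x_i` for which the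
coordinates in `τ` do not vanish simultaneously on `P`. -/
noncomputable def nonfaceIdeal (k : Type*) [Field k] {n : ℕ} (P : Set (Fin n → ℝ)) :
    Ideal (MvPolynomial (Fin n) k) :=
  Ideal.span {m | ∃ τ : Finset (Fin n), ¬ (zeroFace P τ).Nonempty ∧
    m = ∏ i ∈ τ, MvPolynomial.X i}

theorem normalFanStanleyReisnerIdeal_eq_nonfaceIdeal (k : Type*) [Field k] (hw : ∀ i, 0 < w i)
    (hgen : IsGenericWeight A w) :
    normalFanStanleyReisnerIdeal k (fiberPolytope A w) =
      nonfaceIdeal k (fiberPolytope A w) := by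
  simp only [nonfaceIdeal, normalFanStanleyReisnerIdeal, fanStanleyReisnerIdeal, exists_common_cone_iff hw hgen]

end Generic

/-! ### Unimodularity and integral separating functionals -/

section Unimodular

variable {d n : ℕ} {A : Matrix (Fin d) (Fin n) ℤ} {w : Fin n → ℝ}

theorem realMatrix_mulVec_intCast (A : Matrix (Fin d) (Fin n) ℤ) (z : Fin n → ℤ) :
    realMatrix A *ᵥ (fun i => (z i : ℝ)) = fun i => ((A *ᵥ z) i : ℝ) := by
  ext i
  simp [realMatrix, mulVec, dotProduct]

theorem intCast_vecMul_realMatrix (A : Matrix (Fin d) (Fin n) ℤ) (y : Fin d → ℤ) (j : Fin n) :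
    ((fun i => (y i : ℝ)) ᵥ* realMatrix A) j = ((y ᵥ* A) j : ℝ) := by
  simp [realMatrix, vecMul, dotProduct]

theorem eq_zero_of_linearIndepOn_col {M : Matrix (Fin d) (Fin n) ℝ} {B : Set (Fin n)}
    (hB : LinearIndepOn ℝ M.col B) {z : Fin n → ℝ} (hz : ∀ i, i ∉ B → z i = 0)
    (hMz : M *ᵥ z = 0) : z = 0 := by
  have h := linearIndepOn_iff.1 hB (Finsupp.equivFunOnFinite.symm z)
    (by
      rw [Finsupp.mem_supported]
      intro i hi
      by_contra hiB
      exact (Finsupp.mem_support_iff.1 hi) (hz i hiB))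
    (by
      rw [Finsupp.linearCombination_apply, Finsupp.sum_fintype _ _ (by simp), ← hMz]
      ext j
      simp [mulVec, dotProduct, Finset.sum_apply, mul_comm])
  exact funext fun i => DFunLike.congr_fun h i

/-- If `A` is unimodular, the coordinates of an integral vector with respect to independent columns
are integral: after adding a large integer to them, they become a vertex of a fiber. -/
theorem exists_int_coordinate (hU : IsUnimodularMatrix A)
    (hcols : Submodule.span ℤ (Set.range A.col) = ⊤) {B : Set (Fin n)}
    (hB : LinearIndepOn ℝ (realMatrix A).col B) {x : Fin n → ℝ} (hx : ∀ i, i ∉ B → x i = 0)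
    {b : Fin d → ℤ} (hb : realMatrix A *ᵥ x = fun i => (b i : ℝ)) (i : Fin n) :
    ∃ m : ℤ, x i = m := by
  classical
  obtain ⟨c, hc⟩ := (Submodule.mem_span_range_iff_exists_fun ℤ).1
    (hcols ▸ Submodule.mem_top : b ∈ Submodule.span ℤ (Set.range A.col))
  have hAc : A *ᵥ c = b := by
    rw [← hc]
    ext i
    simp [mulVec, dotProduct, Finset.sum_apply, mul_comm]
  obtain ⟨N, hN⟩ := exists_nat_ge (∑ i, |x i|)
  set e : Fin n → ℤ := fun i => if i ∈ B then (N : ℤ) else 0 with he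
  have hbound : ∀ i, -x i ≤ N := fun i =>
    (neg_le_abs (x i)).trans ((Finset.single_le_sum (fun j _ => abs_nonneg (x j))
      (Finset.mem_univ i)).trans hN)
  have hv : (x + fun i => (e i : ℝ)) ∈
      (fiberPolytope A (fun i => ((c + e) i : ℝ))).extremePoints ℝ := by
    refine mem_extremePoints_fiberPolytope_iff.2 ⟨⟨fun i => ?_, ?_⟩, fun z hz hz0 => ?_⟩
    · by_cases hi : i ∈ B
      · simp only [Pi.add_apply, he, if_pos hi]
        push_cast
        linarith [hbound i]
      · simp [he, hi, hx i hi]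
    · rw [mulVec_add, hb, realMatrix_mulVec_intCast, realMatrix_mulVec_intCast, mulVec_add, hAc]
      ext i
      simp
    · refine eq_zero_of_linearIndepOn_col hB (fun i hi => hz0 i ?_) hz
      simp [he, hi, hx i hi]
  obtain ⟨m, hm⟩ := hU _ _ hv i
  refine ⟨m - e i, ?_⟩
  push_cast
  rw [← hm]
  simp

/-- If a functional `y` is determined up to scaling by the columns on which it vanishes, its values
at integral vectors are integral multiples of its value at any other column. -/
theorem exists_int_dotProduct_eq (hU : IsUnimodularMatrix A)
    (hcols : Submodule.span ℤ (Set.range A.col) = ⊤) {y : Fin d → ℝ}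
    (hy : ∀ z : Fin d → ℝ, (∀ j, (y ᵥ* realMatrix A) j = 0 → (z ᵥ* realMatrix A) j = 0) →
      ∃ c : ℝ, z = c • y)
    {j₀ : Fin n} (hj₀ : (y ᵥ* realMatrix A) j₀ ≠ 0) (b : Fin d → ℤ) :
    ∃ m : ℤ, (y ⬝ᵥ fun i => (b i : ℝ)) = m * (y ᵥ* realMatrix A) j₀ := by
  set T : Set (Fin n) := {j | (y ᵥ* realMatrix A) j = 0 ∨ j = j₀} with hT
  have hTspan : Submodule.span ℝ ((realMatrix A).col '' T) = ⊤ := by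
    by_contra hne
    obtain ⟨f, hf0, hf⟩ := Submodule.exists_le_ker_of_lt_top _ (lt_top_iff_ne_top.2 hne)
    obtain ⟨z, hz⟩ := exists_dotProduct_eq_linearMap f
    have hzT : ∀ j ∈ T, (z ᵥ* realMatrix A) j = 0 := by
      intro j hj
      have h := hf (Submodule.subset_span ⟨j, hj, rfl⟩)
      rw [LinearMap.mem_ker, hz] at h
      exact h
    obtain ⟨c, rfl⟩ := hy z fun j hj => hzT j (Or.inl hj)
    have h := hzT j₀ (Or.inr rfl)
    rw [smul_vecMul, Pi.smul_apply, smul_eq_mul] at h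
    have hc := (mul_eq_zero.1 h).resolve_right hj₀
    exact hf0 (LinearMap.ext fun b => by simp [hz, hc])
  obtain ⟨B, hBT, -, hTB, hB⟩ := exists_linearIndepOn_extension
    (linearIndepOn_empty ℝ (realMatrix A).col) (Set.empty_subset T)
  have hBspan : Submodule.span ℝ ((realMatrix A).col '' B) = ⊤ :=
    top_le_iff.1 (hTspan ▸ Submodule.span_le.2 hTB)
  obtain ⟨x, hx, hxb⟩ := exists_mulVec_eq_of_mem_span (realMatrix A) B
    (b := fun i => (b i : ℝ)) (hBspan ▸ Submodule.mem_top)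
  obtain ⟨m, hm⟩ := exists_int_coordinate hU hcols hB hx hxb j₀
  refine ⟨m, ?_⟩
  rw [← hxb, dotProduct_mulVec, dotProduct, Finset.sum_eq_single j₀, hm, mul_comm]
  · intro j _ hj
    by_cases hjB : j ∈ B
    · rw [(hBT hjB).resolve_right hj, zero_mul]
    · rw [hx j hjB, mul_zero]
  · simp

/-- A separating functional that vanishes on as many columns as possible is determined up to
scaling by these columns: otherwise, moving it along a functional that vanishes on them and on `b`
until its sign at a further column is about to change would make it vanish on more columns. -/
theorem exists_separating_determined {M : Matrix (Fin d) (Fin n) ℝ}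
    (hM : ∀ z : Fin d → ℝ, z ᵥ* M = 0 → z = 0) {τ : Finset (Fin n)} {b : Fin d → ℝ}
    (h : ∃ y : Fin d → ℝ, 0 < y ⬝ᵥ b ∧ ∀ j, j ∉ τ → (y ᵥ* M) j ≤ 0) :
    ∃ y : Fin d → ℝ, (0 < y ⬝ᵥ b ∧ ∀ j, j ∉ τ → (y ᵥ* M) j ≤ 0) ∧
      ∀ z : Fin d → ℝ, (∀ j, (y ᵥ* M) j = 0 → (z ᵥ* M) j = 0) → ∃ c : ℝ, z = c • y := by
  classical
  obtain ⟨y, ⟨hyb, hyτ⟩, hmin⟩ := (measure fun y : Fin d → ℝ =>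
    (Finset.univ.filter fun j => (y ᵥ* M) j ≠ 0).card).wf.has_min
      {y | 0 < y ⬝ᵥ b ∧ ∀ j, j ∉ τ → (y ᵥ* M) j ≤ 0} h
  refine ⟨y, ⟨hyb, hyτ⟩, fun z hz => ⟨z ⬝ᵥ b / y ⬝ᵥ b, ?_⟩⟩
  by_contra hne
  set z' : Fin d → ℝ := z - (z ⬝ᵥ b / y ⬝ᵥ b) • y with hz'
  have hz'b : z' ⬝ᵥ b = 0 := by
    rw [hz', sub_dotProduct, smul_dotProduct, smul_eq_mul, div_mul_cancel₀ _ hyb.ne', sub_self]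
  have hz'0 : ∀ j, (y ᵥ* M) j = 0 → (z' ᵥ* M) j = 0 := by
    intro j hj
    rw [hz', sub_vecMul, smul_vecMul, Pi.sub_apply, Pi.smul_apply, hj, hz j hj]
    simp
  have hex : ((Finset.univ.filter fun j => (z' ᵥ* M) j ≠ 0) : Finset (Fin n)).Nonempty := by
    by_contra hempty
    refine hne (sub_eq_zero.1 (hM z' (funext fun j => ?_)))
    by_contra hj
    exact hempty ⟨j, by simpa using hj⟩
  obtain ⟨j₀, hj₀, hj₀min⟩ := Finset.exists_min_image _
    (fun j => |(y ᵥ* M) j / (z' ᵥ* M) j|) hex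
  have hj₀ : (z' ᵥ* M) j₀ ≠ 0 := by simpa using hj₀
  set c : ℝ := (y ᵥ* M) j₀ / (z' ᵥ* M) j₀ with hc
  have hle : ∀ j, |c * (z' ᵥ* M) j| ≤ |(y ᵥ* M) j| := by
    intro j
    by_cases hj : (z' ᵥ* M) j = 0
    · simp [hj]
    · have := hj₀min j (by simpa using hj)
      rw [abs_div ((y ᵥ* M) j), le_div_iff₀ (abs_pos.2 hj)] at this
      rwa [abs_mul]
  have hval : ∀ j, ((y - c • z') ᵥ* M) j = (y ᵥ* M) j - c * (z' ᵥ* M) j := by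
    intro j
    rw [sub_vecMul, smul_vecMul, Pi.sub_apply, Pi.smul_apply, smul_eq_mul]
  refine hmin (y - c • z') ⟨?_, fun j hj => ?_⟩ (Finset.card_lt_card ⟨fun j hj => ?_, fun hsub => ?_⟩)
  · rwa [sub_dotProduct, smul_dotProduct, hz'b, smul_zero, sub_zero]
  · rw [hval]
    have h1 := hle j
    rw [abs_of_nonpos (hyτ j hj)] at h1
    linarith [neg_abs_le (c * (z' ᵥ* M) j)]
  · simp only [Finset.mem_filter, Finset.mem_univ, true_and, hval] at hj ⊢
    intro hj0
    exact hj (by rw [hj0, hz'0 j hj0]; simp)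
  · have hmem : j₀ ∈ Finset.univ.filter fun j => (y ᵥ* M) j ≠ 0 := by
      simpa using fun h => hj₀ (hz'0 j₀ h)
    refine (Finset.mem_filter.1 (hsub hmem)).2 ?_
    rw [hval, hc, div_mul_cancel₀ _ hj₀, sub_self]

theorem eq_zero_of_vecMul_eq_zero (hw : ∀ i, 0 < w i) (hgen : IsGenericWeight A w)
    {z : Fin d → ℝ} (hz : z ᵥ* realMatrix A = 0) : z = 0 := by
  obtain ⟨x, hx, -⟩ := exists_mulVec_eq_and_eq_of_generic hgen (mem_fiberPolytope_self hw) z 0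
  rw [← dotProduct_self_eq_zero]
  calc z ⬝ᵥ z = z ⬝ᵥ (realMatrix A *ᵥ x) := by rw [hx]
    _ = 0 := by rw [dotProduct_mulVec, hz, zero_dotProduct]

/-- If the coordinates in `τ` do not vanish simultaneously on the polytope, this is certified by an
integral functional whose values at the columns are at most `1`, and at most `0` off `τ`. -/
theorem exists_int_separating (hU : IsUnimodularMatrix A)
    (hcols : Submodule.span ℤ (Set.range A.col) = ⊤)
    (hker : ∀ x : Fin n → ℝ, (∀ i, 0 ≤ x i) → realMatrix A *ᵥ x = 0 → x = 0)
    (hw : ∀ i, 0 < w i) (hgen : IsGenericWeight A w) {τ : Finset (Fin n)}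
    (hτ : ¬ (zeroFace (fiberPolytope A w) τ).Nonempty) :
    ∃ y : Fin d → ℤ, 0 < (fun i => (y i : ℝ)) ⬝ᵥ (realMatrix A *ᵥ w) ∧
      (∀ j, (y ᵥ* A) j ≤ 1) ∧ ∀ j, j ∉ τ → (y ᵥ* A) j ≤ 0 := by
  obtain ⟨y, ⟨hyb, hyτ⟩, hdet⟩ := exists_separating_determined
    (fun z hz => eq_zero_of_vecMul_eq_zero hw hgen hz)
    (exists_separating_of_notMem_cone hker τ (b := realMatrix A *ᵥ w)
      fun u hu huτ h => hτ ⟨u, ⟨hu, h⟩, huτ⟩)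
  obtain ⟨j₀, hj₀⟩ : ∃ j, 0 < (y ᵥ* realMatrix A) j := by
    by_contra! hall
    rw [dotProduct_mulVec] at hyb
    exact hyb.not_ge (Finset.sum_nonpos fun j _ =>
      mul_nonpos_of_nonpos_of_nonneg (hall j) (hw j).le)
  choose m hm using fun i => exists_int_dotProduct_eq hU hcols hdet hj₀.ne' (Pi.single i 1)
  have hym : y = (y ᵥ* realMatrix A) j₀ • fun i => (m i : ℝ) := by
    ext i
    have h1 : (fun l => ((Pi.single i 1 : Fin d → ℤ) l : ℝ)) = Pi.single i 1 := by
      ext l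
      by_cases hl : l = i
      · subst hl; simp
      · simp [hl]
    have h := hm i
    rw [h1, dotProduct_single, mul_one] at h
    rw [Pi.smul_apply, smul_eq_mul, mul_comm, ← h]
  have hcol : ∀ j, (y ᵥ* realMatrix A) j = (y ᵥ* realMatrix A) j₀ * ((m ᵥ* A) j : ℝ) := by
    intro j
    conv_lhs => rw [hym, smul_vecMul, Pi.smul_apply, intCast_vecMul_realMatrix, smul_eq_mul]
  refine ⟨m, ?_, fun j => ?_, fun j hj => ?_⟩
  · rw [hym, smul_dotProduct, smul_eq_mul] at hyb
    exact pos_of_mul_pos_right hyb hj₀.le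
  · -- a positive value at the column `j` divides the value `1` at the column `j₀`
    by_contra! hlt
    have hne : (y ᵥ* realMatrix A) j ≠ 0 := by
      rw [hcol]
      exact mul_ne_zero hj₀.ne' (by exact_mod_cast (by omega : (m ᵥ* A) j ≠ 0))
    obtain ⟨q, hq⟩ := exists_int_dotProduct_eq hU hcols hdet hne (A.col j₀)
    have hq' : (y ᵥ* realMatrix A) j₀ = q * (y ᵥ* realMatrix A) j := hq
    rw [hcol j] at hq'
    have h1 : (q : ℝ) * ((m ᵥ* A) j : ℝ) = 1 :=
      mul_left_cancel₀ hj₀.ne' (by linear_combination -hq')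
    have h2 : (m ᵥ* A) j * q = 1 := by
      rw [mul_comm]
      exact_mod_cast h1
    rcases Int.eq_one_or_neg_one_of_mul_eq_one h2 with h3 | h3 <;> omega
  · have h := hyτ j hj
    rw [hcol] at h
    exact_mod_cast nonpos_of_mul_nonpos_right h hj₀

end Unimodular

/-! ### Binomials in the ideal of the matrix -/

section Binomials

variable (k : Type*) [Field k] {d n : ℕ} (A : Matrix (Fin d) (Fin n) ℤ)

theorem toLaurentRing_monomial (u : Fin n →₀ ℕ) (c : k) :
    toLaurentRing k n (MvPolynomial.monomial u c) =
      AddMonoidAlgebra.single (fun j => (u j : ℤ)) c := by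
  have h : (fun j => (u j : ℤ)) = ∑ j, u j • (Pi.single j 1 : Fin n → ℤ) := by
    ext l
    simp [Finset.sum_apply, Pi.single_apply]
  rw [toLaurentRing, MvPolynomial.aeval_monomial, Finsupp.prod_fintype _ _ (by simp), h]
  simp only [AddMonoidAlgebra.single_pow, one_pow, AddMonoidAlgebra.prod_single,
    AddMonoidAlgebra.coe_algebraMap, Function.comp_apply, AddMonoidAlgebra.single_mul_single]
  simp

/-- The exponents congruent to `0` modulo the ideal of the Laurent ring form a group, which contains
the rows of `A`. -/
theorem single_vecMul_sub_one_mem (y : Fin d → ℤ) :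
    AddMonoidAlgebra.single (y ᵥ* A) (1 : k) - 1 ∈
      Ideal.span (Set.range fun i : Fin d => AddMonoidAlgebra.single (A.row i) (1 : k) - 1) := by
  set I : Ideal (AddMonoidAlgebra k (Fin n → ℤ)) :=
    Ideal.span (Set.range fun i : Fin d => AddMonoidAlgebra.single (A.row i) (1 : k) - 1) with hI
  let H : AddSubgroup (Fin n → ℤ) :=
    { carrier := {g | AddMonoidAlgebra.single g (1 : k) - 1 ∈ I}
      zero_mem' := by
        simp [← AddMonoidAlgebra.one_def]
      add_mem' := by
        intro g h hg hh
        have e : AddMonoidAlgebra.single (g + h) (1 : k) - 1 =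
            AddMonoidAlgebra.single g (1 : k) * (AddMonoidAlgebra.single h (1 : k) - 1) +
              (AddMonoidAlgebra.single g (1 : k) - 1) := by
          rw [mul_sub, AddMonoidAlgebra.single_mul_single]
          simp
        change AddMonoidAlgebra.single (g + h) (1 : k) - 1 ∈ I
        rw [e]
        exact I.add_mem (I.mul_mem_left _ hh) hg
      neg_mem' := by
        intro g hg
        have e : AddMonoidAlgebra.single (-g) (1 : k) - 1 =
            -AddMonoidAlgebra.single (-g) (1 : k) * (AddMonoidAlgebra.single g (1 : k) - 1) := by
          rw [mul_sub, neg_mul, AddMonoidAlgebra.single_mul_single]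
          simp [← AddMonoidAlgebra.one_def]
          ring
        change AddMonoidAlgebra.single (-g) (1 : k) - 1 ∈ I
        rw [e]
        exact I.mul_mem_left _ hg }
  have hsum : y ᵥ* A = ∑ i, y i • A.row i := by
    ext j
    simp [vecMul, dotProduct, Finset.sum_apply]
  have : y ᵥ* A ∈ H := by
    rw [hsum]
    exact sum_mem fun i _ => H.zsmul_mem (Ideal.subset_span ⟨i, rfl⟩) _
  exact this

theorem monomial_sub_monomial_mem_rowIdeal {u v : Fin n →₀ ℕ} {y : Fin d → ℤ}
    (h : ∀ j, (u j : ℤ) - v j = (y ᵥ* A) j) :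
    MvPolynomial.monomial u (1 : k) - MvPolynomial.monomial v 1 ∈ rowIdeal k A := by
  rw [rowIdeal, Ideal.mem_comap, map_sub, toLaurentRing_monomial, toLaurentRing_monomial]
  have hu : (fun j => (u j : ℤ)) = (fun j => (v j : ℤ)) + y ᵥ* A := by
    ext j
    simp [← h j]
  have e : AddMonoidAlgebra.single (fun j => (u j : ℤ)) (1 : k) -
      AddMonoidAlgebra.single (fun j => (v j : ℤ)) 1 =
      AddMonoidAlgebra.single (fun j => (v j : ℤ)) 1 *
        (AddMonoidAlgebra.single (y ᵥ* A) (1 : k) - 1) := by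
    rw [mul_sub, AddMonoidAlgebra.single_mul_single, mul_one, mul_one, hu]
  rw [e]
  exact Ideal.mul_mem_left _ _ (single_vecMul_sub_one_mem k A y)

/-- The exponents of a binomial in `J_A` differ by an element of the row lattice of `A`: the ideal
of the Laurent ring vanishes in the group algebra of the quotient of `ℤⁿ` by this lattice. -/
theorem exists_vecMul_eq_of_mem_rowIdeal {f : MvPolynomial (Fin n) k} (hf : f ∈ rowIdeal k A)
    (hcard : f.support.card = 2) {u v : Fin n →₀ ℕ} (hu : u ∈ f.support) (hv : v ∈ f.support)
    (huv : u ≠ v) : ∃ y : Fin d → ℤ, ∀ j, (u j : ℤ) - v j = (y ᵥ* A) j := by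
  classical
  have hsupp : f.support = {u, v} := by
    refine (Finset.eq_of_subset_of_card_le ?_ ?_).symm
    · intro a ha
      rcases Finset.mem_insert.1 ha with rfl | ha
      · exact hu
      · rwa [Finset.mem_singleton.1 ha]
    · rw [hcard, Finset.card_pair huv]
  have hfeq : f = MvPolynomial.monomial u (f.coeff u) + MvPolynomial.monomial v (f.coeff v) := by
    conv_lhs => rw [f.as_sum, hsupp, Finset.sum_pair huv]
  set L : AddSubgroup (Fin n → ℤ) := (A.vecMulLinear).toAddMonoidHom.range with hL
  set q := AddMonoidAlgebra.mapDomainRingHom k (QuotientAddGroup.mk' L) with hq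
  have hqs : ∀ (g : Fin n → ℤ) (c : k),
      q (AddMonoidAlgebra.single g c) = AddMonoidAlgebra.single (QuotientAddGroup.mk' L g) c := by
    intro g c
    simp [hq]
  have hle : Ideal.span (Set.range fun i : Fin d =>
      AddMonoidAlgebra.single (A.row i) (1 : k) - 1) ≤ RingHom.ker q := by
    rw [Ideal.span_le]
    rintro _ ⟨i, rfl⟩
    have hrow : QuotientAddGroup.mk' L (A.row i) = 0 := by
      rw [QuotientAddGroup.mk'_apply, QuotientAddGroup.eq_zero_iff]
      exact ⟨Pi.single i 1, single_one_vecMul i A⟩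
    rw [SetLike.mem_coe, RingHom.mem_ker, map_sub, hqs, hrow, map_one,
      ← AddMonoidAlgebra.one_def, sub_self]
  have h0 : q (toLaurentRing k n f) = 0 := hle hf
  rw [hfeq, map_add, toLaurentRing_monomial, toLaurentRing_monomial, map_add, hqs, hqs] at h0
  have heq : QuotientAddGroup.mk' L (fun j => (u j : ℤ)) =
      QuotientAddGroup.mk' L (fun j => (v j : ℤ)) := by
    by_contra hne
    have hcoeff : ∀ (a b : (Fin n → ℤ) ⧸ L) (c c' : k), a ≠ b →
        AddMonoidAlgebra.single a c + AddMonoidAlgebra.single b c' = 0 → c = 0 := by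
      intro a b c c' hab h
      simpa [Finsupp.single_apply, hab.symm] using congrArg (fun g => g.coeff a) h
    exact (MvPolynomial.mem_support_iff.1 hu) (hcoeff _ _ _ _ hne h0)
  rw [QuotientAddGroup.mk'_apply, QuotientAddGroup.mk'_apply, eq_comm, QuotientAddGroup.eq] at heq
  obtain ⟨y, hy⟩ := heq
  refine ⟨y, fun j => ?_⟩
  have h3 : (y ᵥ* A) j = -(v j : ℤ) + u j := congrFun hy j
  rw [h3]
  ring

end Binomials

/-! ### The initial ideal -/

section Initial

variable {k : Type*} [Field k] {d n : ℕ} {A : Matrix (Fin d) (Fin n) ℤ} {w : Fin n → ℝ}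

/-- The `w`-weight of the exponent `Aᵀ y` is the value of `y` at `A w`. -/
theorem weight_sub_weight {u v : Fin n →₀ ℕ} {y : Fin d → ℤ}
    (h : ∀ j, (u j : ℤ) - v j = (y ᵥ* A) j) :
    Finsupp.weight w u - Finsupp.weight w v =
      (fun i => (y i : ℝ)) ⬝ᵥ (realMatrix A *ᵥ w) := by
  rw [dotProduct_mulVec, Finsupp.weight_apply, Finsupp.weight_apply,
    Finsupp.sum_fintype _ _ (by simp), Finsupp.sum_fintype _ _ (by simp),
    ← Finset.sum_sub_distrib, dotProduct]
  refine Finset.sum_congr rfl fun j _ => ?_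
  rw [intCast_vecMul_realMatrix, ← h j, nsmul_eq_mul, nsmul_eq_mul]
  push_cast
  ring

theorem prod_X_eq_monomial (τ : Finset (Fin n)) :
    ∏ i ∈ τ, (MvPolynomial.X i : MvPolynomial (Fin n) k) =
      MvPolynomial.monomial (∑ i ∈ τ, Finsupp.single i 1) 1 :=
  (MvPolynomial.monomial_sum_one τ _).symm

open Classical in
theorem sum_single_one_apply (τ : Finset (Fin n)) (j : Fin n) :
    (∑ i ∈ τ, Finsupp.single i 1 : Fin n →₀ ℕ) j = if j ∈ τ then 1 else 0 := by
  simp [Finsupp.finsetSum_apply, Finsupp.single_apply]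

/-- For a nonzero functional `y` that is nonnegative at `A w`, the columns at which `y` is positive
form a nonface: at a point of the polytope vanishing on them `y` would be orthogonal to all columns
in the support, which is impossible for generic `w`. -/
theorem not_nonempty_zeroFace_pos (hgen : IsGenericWeight A w) {y : Fin d → ℝ} (hy : y ≠ 0)
    (hyw : 0 ≤ y ⬝ᵥ (realMatrix A *ᵥ w)) {τ : Finset (Fin n)}
    (hτ : ∀ j, 0 < (y ᵥ* realMatrix A) j → j ∈ τ) :
    ¬ (zeroFace (fiberPolytope A w) τ).Nonempty := by
  rintro ⟨p, hp, hpτ⟩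
  rw [← hp.2, dotProduct_mulVec, dotProduct] at hyw
  have hterm : ∀ j ∈ Finset.univ, (y ᵥ* realMatrix A) j * p j ≤ 0 := by
    intro j _
    rcases lt_or_ge 0 ((y ᵥ* realMatrix A) j) with h | h
    · rw [hpτ j (hτ j h), mul_zero]
    · exact mul_nonpos_of_nonpos_of_nonneg h (hp.1 j)
  have hzero := (Finset.sum_eq_zero_iff_of_nonpos hterm).1
    (le_antisymm (Finset.sum_nonpos hterm) hyw)
  obtain ⟨x, hx, hx0⟩ := exists_mulVec_eq_and_eq_of_generic hgen hp y 0
  refine hy (dotProduct_self_eq_zero.1 ?_)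
  calc y ⬝ᵥ y = y ⬝ᵥ (realMatrix A *ᵥ x) := by rw [hx]
    _ = 0 := by
      rw [dotProduct_mulVec]
      refine Finset.sum_eq_zero fun j hj => ?_
      rcases mul_eq_zero.1 (hzero j hj) with h | h
      · rw [h, zero_mul]
      · rw [hx0 j h]
        simp

/-- Every term `u` of the initial form of a binomial in `J_A` is divisible by the monomial of a
nonface, namely of the columns at which the functional `y` with `u - v = Aᵀ y` is positive. This
also covers binomials both of whose terms have maximal weight. -/
theorem initialIdeal_le_nonfaceIdeal (hgen : IsGenericWeight A w) :
    initialIdeal w (rowIdeal k A) ≤ nonfaceIdeal k (fiberPolytope A w) := by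
  classical
  refine Ideal.span_le.2 ?_
  rintro _ ⟨f, hf, hcard, rfl⟩
  refine sum_mem fun u hu => ?_
  obtain ⟨hus, humax⟩ := Finset.mem_filter.1 hu
  obtain ⟨v, hv, hvu⟩ := Finset.exists_mem_ne (by omega : 1 < f.support.card) u
  obtain ⟨y, hy⟩ := exists_vecMul_eq_of_mem_rowIdeal k A hf hcard hus hv hvu.symm
  have hyne : (fun i => (y i : ℝ)) ≠ 0 := by
    intro h0
    have hy0 : y = 0 := funext fun i => by simpa using congrFun h0 i
    refine hvu (Finsupp.ext fun j => ?_)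
    have := hy j
    rw [hy0, zero_vecMul, Pi.zero_apply] at this
    omega
  have hnon := not_nonempty_zeroFace_pos hgen hyne
    (by rw [← weight_sub_weight hy]; exact sub_nonneg.2 (humax v hv))
    (τ := Finset.univ.filter fun j => 0 < (y ᵥ* A) j) (fun j hj => by
      rw [intCast_vecMul_realMatrix] at hj
      simpa using hj)
  refine Ideal.mem_of_dvd _ ?_ (Ideal.subset_span ⟨_, hnon, rfl⟩)
  rw [prod_X_eq_monomial]
  refine ⟨MvPolynomial.monomial
    (u - ∑ i ∈ Finset.univ.filter (fun j => 0 < (y ᵥ* A) j), Finsupp.single i 1) (f.coeff u), ?_⟩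
  rw [MvPolynomial.monomial_mul, one_mul, add_tsub_cancel_of_le]
  intro j
  rw [sum_single_one_apply]
  split_ifs with hj
  · have h1 : 0 < (y ᵥ* A) j := by simpa using hj
    have := hy j
    omega
  · exact Nat.zero_le _

/-- For a nonface `τ` an integral separating functional `y` with values at most `1` gives a binomial
of `J_A` whose initial term, the positive part of `Aᵀ y`, divides the square-free monomial of `τ`. -/
theorem nonfaceIdeal_le_initialIdeal (hU : IsUnimodularMatrix A)
    (hcols : Submodule.span ℤ (Set.range A.col) = ⊤)
    (hker : ∀ x : Fin n → ℝ, (∀ i, 0 ≤ x i) → realMatrix A *ᵥ x = 0 → x = 0)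
    (hw : ∀ i, 0 < w i) (hgen : IsGenericWeight A w) :
    nonfaceIdeal k (fiberPolytope A w) ≤ initialIdeal w (rowIdeal k A) := by
  classical
  refine Ideal.span_le.2 ?_
  rintro _ ⟨τ, hτ, rfl⟩
  obtain ⟨y, hyw, hy1, hyτ⟩ := exists_int_separating hU hcols hker hw hgen hτ
  -- the positive and the negative part of `Aᵀ y`
  set u : Fin n →₀ ℕ := Finsupp.equivFunOnFinite.symm fun j => ((y ᵥ* A) j).toNat with hu
  set v : Fin n →₀ ℕ := Finsupp.equivFunOnFinite.symm fun j => (-(y ᵥ* A) j).toNat with hv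
  have huj : ∀ j, u j = ((y ᵥ* A) j).toNat := fun _ => rfl
  have hvj : ∀ j, v j = (-(y ᵥ* A) j).toNat := fun _ => rfl
  have huv : ∀ j, (u j : ℤ) - v j = (y ᵥ* A) j := by
    intro j
    rw [huj, hvj]
    omega
  have hlt : Finsupp.weight w v < Finsupp.weight w u := by
    rw [← sub_pos, weight_sub_weight huv]
    exact hyw
  have hne : u ≠ v := fun h => by rw [h] at hlt; exact lt_irrefl _ hlt
  set f : MvPolynomial (Fin n) k := MvPolynomial.monomial u 1 - MvPolynomial.monomial v 1 with hf
  have hcu : f.coeff u = 1 := by simp [hf, MvPolynomial.coeff_monomial, hne.symm]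
  have hsupp : f.support = {u, v} := by
    ext a
    rw [MvPolynomial.mem_support_iff, hf, MvPolynomial.coeff_sub, MvPolynomial.coeff_monomial,
      MvPolynomial.coeff_monomial, Finset.mem_insert, Finset.mem_singleton]
    by_cases h1 : u = a
    · subst h1
      simp [hne.symm]
    · by_cases h2 : v = a
      · subst h2
        simp [h1]
      · simp [h1, h2, Ne.symm h1, Ne.symm h2]
  have hin : initialForm w f = MvPolynomial.monomial u 1 := by
    rw [initialForm, hsupp]
    have hfilter : ({u, v} : Finset (Fin n →₀ ℕ)).filter
        (fun a => ∀ b ∈ ({u, v} : Finset (Fin n →₀ ℕ)),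
          Finsupp.weight w b ≤ Finsupp.weight w a) = {u} := by
      ext a
      simp only [Finset.mem_filter, Finset.mem_insert, Finset.mem_singleton, forall_eq_or_imp,
        forall_eq]
      constructor
      · rintro ⟨rfl | rfl, h1, h2⟩
        · rfl
        · exact absurd h1 hlt.not_ge
      · rintro rfl
        exact ⟨Or.inl rfl, le_refl _, hlt.le⟩
    simp only [hfilter, Finset.sum_singleton, hcu]
  have hmem : (MvPolynomial.monomial u 1 : MvPolynomial (Fin n) k) ∈
      initialIdeal w (rowIdeal k A) :=
    Ideal.subset_span ⟨f, monomial_sub_monomial_mem_rowIdeal k A huv,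
      by rw [hsupp, Finset.card_pair hne], hin.symm⟩
  refine Ideal.mem_of_dvd _ ?_ hmem
  rw [prod_X_eq_monomial]
  refine ⟨MvPolynomial.monomial ((∑ i ∈ τ, Finsupp.single i 1) - u) 1, ?_⟩
  rw [MvPolynomial.monomial_mul, one_mul, add_tsub_cancel_of_le]
  intro j
  rw [sum_single_one_apply, huj]
  split_ifs with hj
  · have := hy1 j
    omega
  · have := hyτ j hj
    omega

end Initial

/-! ### Minimal primes of the ideal of nonfaces -/

section MinimalPrimes

variable (k : Type*) [Field k] {d n : ℕ} {A : Matrix (Fin d) (Fin n) ℤ} {w : Fin n → ℝ}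

/-- The ideal generated by the variables `x_j` with `j ∈ S`. -/
noncomputable def variableIdeal (S : Set (Fin n)) : Ideal (MvPolynomial (Fin n) k) :=
  Ideal.span (MvPolynomial.X '' S)

/-- The ideal generated by a set of variables is the kernel of setting them to zero. -/
theorem isPrime_variableIdeal (S : Set (Fin n)) : (variableIdeal k S).IsPrime := by
  classical
  let φ : MvPolynomial (Fin n) k →ₐ[k] MvPolynomial (Fin n) k :=
    MvPolynomial.aeval fun j => if j ∈ S then 0 else MvPolynomial.X j
  have hφ : ∀ f, f - φ f ∈ variableIdeal k S := by
    have hmk : (Ideal.Quotient.mkₐ k (variableIdeal k S)).comp φ =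
        Ideal.Quotient.mkₐ k (variableIdeal k S) := by
      refine MvPolynomial.algHom_ext fun j => ?_
      simp only [AlgHom.comp_apply, φ, MvPolynomial.aeval_X]
      split_ifs with hj
      · rw [map_zero]
        exact (Ideal.Quotient.eq_zero_iff_mem.2
          (Ideal.subset_span (Set.mem_image_of_mem MvPolynomial.X hj))).symm
      · rfl
    intro f
    exact Ideal.Quotient.eq.1 (DFunLike.congr_fun hmk f).symm
  have hker : variableIdeal k S = RingHom.ker φ := by
    refine le_antisymm (Ideal.span_le.2 ?_) fun f hf => ?_
    · rintro _ ⟨j, hj, rfl⟩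
      simp [φ, RingHom.mem_ker, hj]
    · have h := hφ f
      rwa [(RingHom.mem_ker).1 hf, sub_zero] at h
  rw [hker]
  exact RingHom.ker_isPrime _

theorem variableIdeal_le_iff {S T : Set (Fin n)} :
    variableIdeal k S ≤ variableIdeal k T ↔ S ⊆ T := by
  refine ⟨fun h j hj => ?_, fun h => Ideal.span_mono (Set.image_mono h)⟩
  have hmem : (MvPolynomial.X j : MvPolynomial (Fin n) k) ∈ variableIdeal k T :=
    h (Ideal.subset_span ⟨j, hj, rfl⟩)
  obtain ⟨i, hi, hne⟩ := MvPolynomial.mem_ideal_span_X_image.1 hmem (Finsupp.single j 1)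
    (by simp [MvPolynomial.support_X])
  rw [Finsupp.single_apply] at hne
  have hji : j = i := by
    by_contra h
    simp [h] at hne
  rwa [hji]

theorem nonfaceIdeal_le_variableIdeal {u : Fin n → ℝ} {P : Set (Fin n → ℝ)} (hu : u ∈ P)
    {S : Set (Fin n)} (hS : ∀ i, u i ≠ 0 → i ∈ S) : nonfaceIdeal k P ≤ variableIdeal k S := by
  refine Ideal.span_le.2 ?_
  rintro _ ⟨τ, hτ, rfl⟩
  obtain ⟨j, hj, hju⟩ : ∃ j ∈ τ, u j ≠ 0 := by
    by_contra! h
    exact hτ ⟨u, hu, h⟩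
  exact Ideal.mem_of_dvd _ (Finset.dvd_prod_of_mem _ hj) (Ideal.subset_span ⟨j, hS j hju, rfl⟩)

/-- A prime over the ideal of nonfaces contains the variables in the support of some vertex. -/
theorem exists_variableIdeal_support_le
    (hker : ∀ x : Fin n → ℝ, (∀ i, 0 ≤ x i) → realMatrix A *ᵥ x = 0 → x = 0)
    {Q : Ideal (MvPolynomial (Fin n) k)} (hQ : Q.IsPrime)
    (hle : nonfaceIdeal k (fiberPolytope A w) ≤ Q) :
    ∃ v ∈ (fiberPolytope A w).extremePoints ℝ, variableIdeal k {j | v j ≠ 0} ≤ Q := by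
  classical
  set τ : Finset (Fin n) :=
    Finset.univ.filter fun j => (MvPolynomial.X j : MvPolynomial (Fin n) k) ∉ Q with hτdef
  have hτ : (zeroFace (fiberPolytope A w) τ).Nonempty := by
    by_contra hne
    obtain ⟨j, hj, hjQ⟩ := (Ideal.IsPrime.prod_mem_iff (hp := hQ)).1
      (hle (Ideal.subset_span ⟨τ, hne, rfl⟩))
    exact (Finset.mem_filter.1 hj).2 hjQ
  obtain ⟨v, hv, hvτ⟩ := exists_extremePoint_mem_zeroFace hker hτ
  refine ⟨v, hv, Ideal.span_le.2 ?_⟩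
  rintro _ ⟨j, hj, rfl⟩
  by_contra hjQ
  exact hj (hvτ j (by simpa [hτdef] using hjQ))

theorem eq_of_variableIdeal_support_le {u v : Fin n → ℝ} (hu : u ∈ fiberPolytope A w)
    (hv : v ∈ (fiberPolytope A w).extremePoints ℝ)
    (h : variableIdeal k {j | u j ≠ 0} ≤ variableIdeal k {j | v j ≠ 0}) : u = v :=
  eq_of_mem_extremePoints_of_support_le hv hu fun i hi => by
    by_contra hne
    exact (variableIdeal_le_iff k).1 h hne hi

theorem variableIdeal_support_mem_minimalPrimes
    (hker : ∀ x : Fin n → ℝ, (∀ i, 0 ≤ x i) → realMatrix A *ᵥ x = 0 → x = 0)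
    {v : Fin n → ℝ} (hv : v ∈ (fiberPolytope A w).extremePoints ℝ) :
    variableIdeal k {j | v j ≠ 0} ∈ (nonfaceIdeal k (fiberPolytope A w)).minimalPrimes := by
  refine ⟨⟨isPrime_variableIdeal k _, nonfaceIdeal_le_variableIdeal k hv.1 fun _ hi => hi⟩, ?_⟩
  rintro Q ⟨hQ, hle⟩ hQv
  obtain ⟨u, hu, huQ⟩ := exists_variableIdeal_support_le k hker hQ hle
  exact eq_of_variableIdeal_support_le k hu.1 hv (huQ.trans hQv) ▸ huQ

theorem bijOn_variableIdeal_support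
    (hker : ∀ x : Fin n → ℝ, (∀ i, 0 ≤ x i) → realMatrix A *ᵥ x = 0 → x = 0) (w : Fin n → ℝ) :
    Set.BijOn (fun v : Fin n → ℝ => variableIdeal k {j | v j ≠ 0})
      ((fiberPolytope A w).extremePoints ℝ)
      (nonfaceIdeal k (fiberPolytope A w)).minimalPrimes := by
  refine ⟨fun v hv => variableIdeal_support_mem_minimalPrimes k hker hv, ?_, ?_⟩
  · intro u hu v hv huv
    exact eq_of_variableIdeal_support_le k hu.1 hv (le_of_eq huv)
  · intro Q hQ
    obtain ⟨v, hv, hvQ⟩ := exists_variableIdeal_support_le k hker hQ.1.1 hQ.1.2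
    exact ⟨v, hv, le_antisymm hvQ
      (hQ.2 (variableIdeal_support_mem_minimalPrimes k hker hv).1 hvQ)⟩

theorem exists_zeroFace_eq_singleton_iff
    (hker : ∀ x : Fin n → ℝ, (∀ i, 0 ≤ x i) → realMatrix A *ᵥ x = 0 → x = 0)
    (hgen : IsGenericWeight A w) {I : Finset (Fin n)} (hI : I.card + d = n) :
    (∃ v ∈ (fiberPolytope A w).extremePoints ℝ, zeroFace (fiberPolytope A w) I = {v}) ↔
      variableIdeal k {j | j ∉ I} ∈ (nonfaceIdeal k (fiberPolytope A w)).minimalPrimes := by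
  classical
  constructor
  · rintro ⟨v, hv, hIv⟩
    have hvI : v ∈ zeroFace (fiberPolytope A w) I := hIv ▸ rfl
    have hcard := card_filter_eq_zero_of_mem_extremePoints hgen hv
    have hIeq : I = Finset.univ.filter fun i => v i = 0 :=
      Finset.eq_of_subset_of_card_le (fun i hi => by simpa using hvI.2 i hi) (by omega)
    have hset : {j | j ∉ I} = {j | v j ≠ 0} := by
      ext j
      simp [hIeq]
    rw [hset]
    exact variableIdeal_support_mem_minimalPrimes k hker hv
  · intro hmin
    obtain ⟨v, hv, hvI⟩ := (bijOn_variableIdeal_support k hker w).surjOn hmin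
    have hvI : variableIdeal k {j | v j ≠ 0} = variableIdeal k {j | j ∉ I} := hvI
    have hzero : ∀ i, i ∈ I → v i = 0 := fun i hi => by
      by_contra hne
      exact (variableIdeal_le_iff k).1 hvI.le hne hi
    refine ⟨v, hv, Set.eq_singleton_iff_unique_mem.2 ⟨⟨hv.1, hzero⟩, fun u hu => ?_⟩⟩
    refine eq_of_mem_extremePoints_of_support_le hv hu.1 fun i hi => hu.2 i ?_
    by_contra hiI
    exact (variableIdeal_le_iff k).1 hvI.ge hiI hi

end MinimalPrimes

/-! ### The initial ideal of a generic weight and the normal fan -/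

theorem mainTheorem5 (k : Type*) [Field k] [CharZero k] {d n : ℕ}
    (A : Matrix (Fin d) (Fin n) ℤ)
    (hunimodular : IsUnimodularMatrix A)
    (hcols : Submodule.span ℤ (Set.range A.col) = ⊤)
    (hker : ∀ x : Fin n → ℝ, (∀ i, 0 ≤ x i) → (realMatrix A).mulVec x = 0 → x = 0)
    (w : Fin n → ℝ) (hw : ∀ i, 0 < w i) (hgeneric : IsGenericWeight A w) :
    IsSimplePolytope (fiberPolytope A w) ∧
    initialIdeal w (rowIdeal k A) = normalFanStanleyReisnerIdeal k (fiberPolytope A w) ∧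
    (∀ I : Finset (Fin n), I.card + d = n →
      ((∃ v ∈ (fiberPolytope A w).extremePoints ℝ,
          {u ∈ fiberPolytope A w | ∀ i ∈ I, u i = 0} = {v}) ↔
        Ideal.span {p | ∃ j, j ∉ I ∧ p = (MvPolynomial.X j : MvPolynomial (Fin n) k)} ∈
          (initialIdeal w (rowIdeal k A)).minimalPrimes)) ∧
    Set.BijOn
      (fun v : Fin n → ℝ =>
        Ideal.span {p | ∃ j, v j ≠ 0 ∧ p = (MvPolynomial.X j : MvPolynomial (Fin n) k)})
      ((fiberPolytope A w).extremePoints ℝ)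
      (initialIdeal w (rowIdeal k A)).minimalPrimes := by
  have hM : initialIdeal w (rowIdeal k A) = nonfaceIdeal k (fiberPolytope A w) :=
    le_antisymm (initialIdeal_le_nonfaceIdeal hgeneric)
      (nonfaceIdeal_le_initialIdeal hunimodular hcols hker hw hgeneric)
  have hvar : ∀ q : Fin n → Prop,
      Ideal.span {p | ∃ j, q j ∧ p = (MvPolynomial.X j : MvPolynomial (Fin n) k)} =
        variableIdeal k {j | q j} := by
    intro q
    simp only [variableIdeal, Set.image, Set.mem_ofPred_eq, eq_comm]
  simp only [hvar, hM]
  exact ⟨isSimplePolytope_fiberPolytope hker hw hgeneric,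
    (normalFanStanleyReisnerIdeal_eq_nonfaceIdeal k hw hgeneric).symm,
    fun I hI => exists_zeroFace_eq_singleton_iff k hker hgeneric hI,
    bijOn_variableIdeal_support k hker w⟩
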